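/- **Proposition 3.1.** Let $\mathbf a=(a_1,\dots,a_r)\in\mathbb Z^r$ and $v_1,\dots,v_r\in\mathbb Z^n$ with $\sum_i v_i=0$. Put $H_i=\{x\in\mathbb R^n:\langle v_i,x\rangle+a_i=0\}$ and $P=\bigcap_i\{x\in\mathbb R^n:\langle v_i,x\rangle+a_i\ge 0\}$. Assume that $P$ is compact, that $H_i\cap P\neq\emptyset$ for every $i$, and that $kP\cap\mathbb Z^n\ne\emptyset$ for all sufficiently large integers $k$. For such $k$ let $\mathbf X_{k\mathbf a}$ be the random vector with $$\mathbb P(\mathbf X_{k\mathbf a}=x)=\frac1{b_k}\binom{k\sum_i a_i}{\langle v_1,x\rangle+ka_1,\dots,\langle v_r,x\rangle+ka_r}\qquad(x\in kP\cap\mathbb Z^n),$$ where $b_k$ is the sum of these multinomial coefficients over $kP\cap\mathbb Z^n$. Let $L\subset\mathbb R^n$ be the linear span of the differences of points of $P$, let $I_{\mathbf a}$ be the set of indices $i$ such that $x\mapsto\langle v_i,x\rangle$ is not constant on $P$, and let $m_{\mathbf a}$ be the unique point of the relative interior of $P$ that minimises $\phi_{\mathbf a}(x)=\prod_{i=1}^r(\langle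 v_i,x\rangle+a_i)^{\langle v_i,x\rangle+a_i}$ (with $0^0=1$) over $P$. Let $\nu'_k$ be the law of $(\mathbf X_{k\mathbf a}-km_{\mathbf a})/\sqrt k$, and write $B_R(y)$ for the open Euclidean ball of radius $R$ about $y$. Let $0<c<\frac16$. Then there are constants $d_k>0$ such that, as $k\to\infty$, the measures $$\nu'_k\qquad\text{and}\qquad\frac1{d_k}\sum_{x\in B_{k^c}(0)\cap L\cap\frac{\mathbb Z^n-km_{\mathbf a}}{\sqrt k}}\exp\Bigl(-\frac12\sum_{i\in I_{\mathbf a}}\frac{\langle v_i,x\rangle^2}{\langle v_i,m_{\mathbf a}\rangle+a_i}\Bigr)\,\delta_x$$ both converge weakly, to the same probability measure on $\mathbb R^n$. Moreover $\mathbb P\bigl(\mathbf X_{k\mathbf a}\notin B_{k^{1/2+c}}(km_{\mathbf a})\bigr)\to0$ as $k\to\infty$. -/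

import Mathlib

open MeasureTheory Filter Topology
open scoped NNReal ENNReal

noncomputable section

namespace PolyMultinomial

/-- Euclidean space `ℝⁿ`. -/
abbrev E (n : ℕ) : Type := EuclideanSpace ℝ (Fin n)

/-- The inclusion of the lattice `ℤⁿ` in `ℝⁿ`. -/
def latticePoint {n : ℕ} (z : Fin n → ℤ) : E n :=
  WithLp.toLp 2 (fun j => (z j : ℝ))

/-- The pairing `⟨w, x⟩` of an integer vector `w` with a real vector `x`. -/
def pairing {n : ℕ} (w : Fin n → ℤ) (x : E n) : ℝ :=
  ∑ j, (w j : ℝ) * x j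

/-- The polyhedron `P = ⋂ᵢ {x | ⟨vᵢ, x⟩ + aᵢ ≥ 0}`. -/
def polyhedron {n r : ℕ} (v : Fin r → Fin n → ℤ) (a : Fin r → ℤ) : Set (E n) :=
  {x | ∀ i, 0 ≤ pairing (v i) x + (a i : ℝ)}

/-- The hyperplane `Hᵢ = {x | ⟨vᵢ, x⟩ + aᵢ = 0}`. -/
def hyperplane {n r : ℕ} (v : Fin r → Fin n → ℤ) (a : Fin r → ℤ) (i : Fin r) : Set (E n) :=
  {x | pairing (v i) x + (a i : ℝ) = 0}

/-- The lattice points `P ∩ ℤⁿ`, as integer vectors. -/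
def latticePoints {n r : ℕ} (v : Fin r → Fin n → ℤ) (a : Fin r → ℤ) : Set (Fin n → ℤ) :=
  {z | latticePoint z ∈ polyhedron v a}

/-- The multinomial coefficient with lower entries `⟨vᵢ, z⟩ + aᵢ` (nonnegative when `z ∈ P`) and
upper entry their sum, which is `∑ᵢ aᵢ` when `∑ᵢ vᵢ = 0`. -/
def coeff {n r : ℕ} (v : Fin r → Fin n → ℤ) (a : Fin r → ℤ) (z : Fin n → ℤ) : ℕ :=
  Nat.multinomial Finset.univ (fun i => (∑ j, v i j * z j + a i).toNat)

/-- The unnormalised measure `∑_{z ∈ P ∩ ℤⁿ} coeff(z) δ_z`. -/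
def weightMeasure {n r : ℕ} (v : Fin r → Fin n → ℤ) (a : Fin r → ℤ) : Measure (E n) :=
  Measure.sum fun z : latticePoints v a =>
    (coeff v a z.1 : ℝ≥0∞) • Measure.dirac (latticePoint z.1)

/-- The polyhedral multinomial distribution `μ_a`, the law of `X_a`: the measure `weightMeasure`
divided by its total mass `b`. -/
def law {n r : ℕ} (v : Fin r → Fin n → ℤ) (a : Fin r → ℤ) : Measure (E n) :=
  (weightMeasure v a Set.univ)⁻¹ • weightMeasure v a

instance isFiniteMeasure_law {n r : ℕ} (v : Fin r → Fin n → ℤ) (a : Fin r → ℤ) :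
    IsFiniteMeasure (law v a) :=
  ⟨by
    rw [law, Measure.smul_apply, smul_eq_mul]
    exact lt_of_le_of_lt (ENNReal.inv_mul_le_one _) ENNReal.one_lt_top⟩

/-- The potential `φ_a(x) = ∏ᵢ (⟨vᵢ, x⟩ + aᵢ)^(⟨vᵢ, x⟩ + aᵢ)`, used on `P`, with `0⁰ = 1`. -/
def potential {n r : ℕ} (v : Fin r → Fin n → ℤ) (a : Fin r → ℤ) (x : E n) : ℝ :=
  ∏ i, (pairing (v i) x + (a i : ℝ)) ^ (pairing (v i) x + (a i : ℝ))

/-- The point `m_a`: the minimiser of the potential on `P` lying in the relative interior. -/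
def minPoint {n r : ℕ} (v : Fin r → Fin n → ℤ) (a : Fin r → ℤ) : E n :=
  Classical.epsilon fun m =>
    m ∈ intrinsicInterior ℝ (polyhedron v a) ∧ IsMinOn (potential v a) (polyhedron v a) m

open scoped Classical in
/-- The set `I_a` of the indices `i` such that `⟨vᵢ, x⟩` is not constant on `P`. -/
def varyingIndices {n r : ℕ} (v : Fin r → Fin n → ℤ) (a : Fin r → ℤ) : Finset (Fin r) :=
  Finset.univ.filter fun i =>
    ∃ x ∈ polyhedron v a, ∃ y ∈ polyhedron v a, pairing (v i) x ≠ pairing (v i) y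

/-- The linear subspace `L` spanned by the differences of points of `P`. -/
def directionSpace {n r : ℕ} (v : Fin r → Fin n → ℤ) (a : Fin r → ℤ) : Submodule ℝ (E n) :=
  vectorSpan ℝ (polyhedron v a)

/-- The quadratic form `∑_{i ∈ I_a} ⟨vᵢ, x⟩² / (⟨vᵢ, m_a⟩ + aᵢ)`. -/
def quadForm {n r : ℕ} (v : Fin r → Fin n → ℤ) (a : Fin r → ℤ) (x : E n) : ℝ :=
  ∑ i ∈ varyingIndices v a,
    pairing (v i) x ^ 2 / (pairing (v i) (minPoint v a) + (a i : ℝ))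

/-- The multiple `k · a`. -/
def dilate {r : ℕ} (k : ℕ) (a : Fin r → ℤ) : Fin r → ℤ := fun i => (k : ℤ) * a i

/-- The map `y ↦ (y - k m_a) / √k`. -/
def rescale {n r : ℕ} (v : Fin r → Fin n → ℤ) (a : Fin r → ℤ) (k : ℕ) (y : E n) : E n :=
  (Real.sqrt k)⁻¹ • (y - (k : ℝ) • minPoint v a)

/-- The measure `ν'_k`, the law of `(X_{ka} - k m_a) / √k`. -/
def nuPrime {n r : ℕ} (v : Fin r → Fin n → ℤ) (a : Fin r → ℤ) (k : ℕ) : FiniteMeasure (E n) :=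
  ⟨(law v (dilate k a)).map (rescale v a k), inferInstance⟩

/-- The finite set `B_{k^c}(0) ∩ L ∩ (ℤⁿ - k m_a) / √k`. -/
def gaussSupport {n r : ℕ} (v : Fin r → Fin n → ℤ) (a : Fin r → ℤ) (c : ℝ) (k : ℕ) :
    Set (E n) :=
  Metric.ball 0 ((k : ℝ) ^ c) ∩ (directionSpace v a : Set (E n)) ∩
    Set.range (fun z : Fin n → ℤ => rescale v a k (latticePoint z))

theorem finite_gaussSupport {n r : ℕ} (v : Fin r → Fin n → ℤ) (a : Fin r → ℤ) (c : ℝ) (k : ℕ) :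
    (gaussSupport v a c k).Finite := by
  rcases Nat.eq_zero_or_pos k with rfl | hk
  · refine (Set.finite_singleton (0 : E n)).subset ?_
    rintro _ ⟨-, z, rfl⟩
    simp [rescale]
  · have hs : 0 < Real.sqrt k := Real.sqrt_pos.2 (by exact_mod_cast hk)
    set R : ℝ := Real.sqrt k * (k : ℝ) ^ c + ‖(k : ℝ) • minPoint v a‖ with hR
    have hfin : (Metric.closedBall (0 : Fin n → ℤ) R).Finite :=
      (isCompact_closedBall (0 : Fin n → ℤ) R).finite_of_discrete
    refine (hfin.image (fun z => rescale v a k (latticePoint z))).subset ?_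
    rintro _ ⟨⟨hb, -⟩, z, rfl⟩
    refine ⟨z, ?_, rfl⟩
    have hb' : ‖rescale v a k (latticePoint z)‖ < (k : ℝ) ^ c := by simpa using hb
    rw [rescale, norm_smul, norm_inv, Real.norm_of_nonneg hs.le, inv_mul_lt_iff₀ hs] at hb'
    have h1 : ‖latticePoint z‖ ≤ R := by
      have := norm_le_norm_sub_add (latticePoint z) ((k : ℝ) • minPoint v a)
      linarith
    have hR0 : 0 ≤ R := (norm_nonneg _).trans h1
    rw [mem_closedBall_zero_iff, pi_norm_le_iff_of_nonneg hR0]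
    intro j
    refine le_trans ?_ h1
    have := PiLp.norm_apply_le (latticePoint z) j
    rw [← Int.norm_cast_real]
    exact this

/-- The unnormalised Gaussian-weighted sum of Dirac masses
`∑_{x ∈ B_{k^c}(0) ∩ L ∩ (ℤⁿ - k m_a)/√k} exp(-½ ∑_{i ∈ I_a} ⟨vᵢ, x⟩² / (⟨vᵢ, m_a⟩ + aᵢ)) δ_x`. -/
def gaussSum {n r : ℕ} (v : Fin r → Fin n → ℤ) (a : Fin r → ℤ) (c : ℝ) (k : ℕ) :
    FiniteMeasure (E n) :=
  ⟨∑ x ∈ (finite_gaussSupport v a c k).toFinset,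
      Real.toNNReal (Real.exp (-(1 / 2) * quadForm v a x)) • Measure.dirac x, inferInstance⟩

end PolyMultinomial

end

namespace PolyMultinomial

/-! The multinomial coefficient is compared with a product of Poisson weights of means `t i = k
(⟨vᵢ, m⟩ + aᵢ)`, where `m` is the minimiser and `i` runs over the varying indices. On `kP` the upper
entry is constant, and the power factor `∏ t i ^ N i` is constant too: its logarithm is affine in
the lattice point, and its linear part vanishes by `∑ vᵢ = 0` and the first order condition at `m`.
So the two agree up to a factor depending only on `k` (`exists_coeff_eq_mul_poissonProd`), which
cancels in the normalised law. Stirling's formula then gives the local limit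
`tendsto_scaledPoisson`, whose product over `i` is `exp (-Q / 2)` with `Q` the quadratic form, and
the uniform Gaussian bound `exists_poissonProd_le`. The relevant lattice points, centred at `k m`
and divided by `√k`, are a linear image of shifted copies of `ℤᵈ` of mesh `1 / √k`, because `L` is a
rational subspace. By dominated convergence, sums over them with either family of weights tend to
the same integral against `exp (-Q / 2)` on `L` (`tendsto_weighted_lattice_sum`). Hence both
sequences have the same Gaussian limit. Test functions may vary with `k`, so the tail estimate is
another instance of the same convergence. -/

/-! ### Lattice sums as integrals of step functions. -/

theorem map_floor_volume {ι : Type*} [Fintype ι] :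
    (volume : Measure (ι → ℝ)).map (fun x j => ⌊x j⌋) = Measure.count := by
  have hm : Measurable (fun (x : ι → ℝ) j => ⌊x j⌋) :=
    measurable_pi_lambda _ fun j => Int.measurable_floor.comp (measurable_pi_apply j)
  refine Measure.ext_iff_singleton.2 fun w => ?_
  rw [Measure.map_apply hm (measurableSet_singleton w), Measure.count_singleton]
  have : (fun (x : ι → ℝ) j => ⌊x j⌋) ⁻¹' {w} =
      Set.univ.pi fun j => Set.Ico (w j : ℝ) (w j + 1) := by
    ext x
    simp [funext_iff, Int.floor_eq_iff]
  rw [this, volume_pi_pi]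
  simp

/-- No summability is assumed: if `g` is not summable, both sides take the default value `0`. -/
theorem integral_floor_eq_tsum {ι : Type*} [Fintype ι] (g : (ι → ℤ) → ℝ) :
    ∫ x : ι → ℝ, g (fun j => ⌊x j⌋) = ∑' w, g w := by
  have hm : Measurable (fun (x : ι → ℝ) j => ⌊x j⌋) :=
    measurable_pi_lambda _ fun j => Int.measurable_floor.comp (measurable_pi_apply j)
  rw [← integral_map (f := g) hm.aemeasurable (Measurable.of_discrete).aestronglyMeasurable,
    map_floor_volume]
  by_cases hg : Integrable g Measure.count
  · rw [integral_countable hg]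
    simp [Measure.real]
  · rw [integral_undef hg, tsum_eq_zero_of_not_summable]
    rwa [integrable_count_iff, summable_norm_iff] at hg

theorem integral_floor_affine_eq_tsum {d : ℕ} (g : (Fin d → ℤ) → ℝ) {h : ℝ} (hh : 0 < h)
    (s : Fin d → ℝ) :
    ∫ x : Fin d → ℝ, g (fun j => ⌊h⁻¹ * x j - s j⌋) = h ^ d * ∑' w, g w := by
  have h1 := Measure.integral_comp_inv_smul_of_nonneg (volume : Measure (Fin d → ℝ))
    (fun y => g (fun j => ⌊y j - s j⌋)) hh.le
  simp only [Pi.smul_apply, smul_eq_mul, Module.finrank_fintype_fun_eq_card,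
    Fintype.card_fin] at h1
  rw [h1, ← integral_floor_eq_tsum]
  congr 1
  exact integral_sub_right_eq_self (fun y : Fin d → ℝ => g (fun j => ⌊y j⌋)) s

theorem integrable_exp_neg_mul_sum_sq {ι : Type*} [Fintype ι] {b : ℝ} (hb : 0 < b) :
    Integrable (fun x : ι → ℝ => Real.exp (-b * ∑ j, x j ^ 2)) := by
  have := Integrable.fintype_prod (μ := fun _ : ι => (volume : Measure ℝ))
    (f := fun _ : ι => fun t : ℝ => Real.exp (-b * t ^ 2))
    (fun _ => integrable_exp_neg_mul_sq hb)
  refine this.congr (Eventually.of_forall fun x => ?_)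
  simp only [Finset.mul_sum, Real.exp_sum]

/-- Riemann sums over the shifted lattices `h (ℤᵈ + s)`, with Gaussian domination. -/
theorem tendsto_shifted_lattice_sum {d : ℕ} {h : ℕ → ℝ} (hpos : ∀ᶠ k in atTop, 0 < h k)
    (hlim0 : Tendsto h atTop (𝓝 0)) (s : ℕ → Fin d → ℝ) (G : ℕ → (Fin d → ℤ) → ℝ)
    (F : (Fin d → ℝ) → ℝ) {C α : ℝ} (hα : 0 < α)
    (hbd : ∀ᶠ k in atTop, ∀ w,
      |G k w| ≤ C * Real.exp (-α * ∑ j, (h k * (w j + s k j)) ^ 2))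
    (hlim : ∀ x (w : ℕ → Fin d → ℤ),
      Tendsto (fun k j => h k * (w k j + s k j)) atTop (𝓝 x) →
      Tendsto (fun k => G k (w k)) atTop (𝓝 (F x))) :
    Tendsto (fun k => h k ^ d * ∑' w, G k w) atTop (𝓝 (∫ x, F x)) := by
  have hC : 0 ≤ C := by
    obtain ⟨k, hk⟩ := hbd.exists
    exact nonneg_of_mul_nonneg_left ((abs_nonneg _).trans (hk 0)) (Real.exp_pos _)
  -- Rounding to a point of the shifted lattice moves each coordinate by at most the mesh.
  have key : ∀ {h t s : ℝ}, 0 < h → |h * (⌊h⁻¹ * t - s⌋ + s) - t| ≤ h := by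
    intro h t s hh
    have e : h * (⌊h⁻¹ * t - s⌋ + s) - t = -(h * Int.fract (h⁻¹ * t - s)) := by
      rw [Int.fract]; field_simp; ring
    rw [e, abs_neg, abs_of_nonneg (mul_nonneg hh.le (Int.fract_nonneg _))]
    exact mul_le_of_le_one_right hh.le (Int.fract_lt_one _).le
  have hT : Tendsto (fun k => ∫ x : Fin d → ℝ, G k (fun j => ⌊(h k)⁻¹ * x j - s k j⌋)) atTop
      (𝓝 (∫ x, F x)) := by
    refine tendsto_integral_filter_of_dominated_convergence
      -- Once the mesh is at most `1`, a rounded coordinate `y` satisfies `y² ≥ x² / 2 - 1`; this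
      -- halves `α` and costs the factor `exp (α d)`.
      (fun x => C * Real.exp (α * d) * Real.exp (-(α / 2) * ∑ j, x j ^ 2)) ?_ ?_ ?_ ?_
    · refine Eventually.of_forall fun k => Measurable.aestronglyMeasurable ?_
      refine (Measurable.of_discrete (f := G k)).comp (measurable_pi_lambda _ fun j => ?_)
      exact Int.measurable_floor.comp (((measurable_pi_apply j).const_mul _).sub_const _)
    · filter_upwards [hbd, hpos, hlim0.eventually (ge_mem_nhds (zero_lt_one))] with k hk hk0 hk1
      refine Eventually.of_forall fun x => (hk _).trans ?_
      rw [mul_assoc, ← Real.exp_add]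
      refine mul_le_mul_of_nonneg_left (Real.exp_le_exp.2 ?_) hC
      have : ∑ j, (x j ^ 2 / 2 - 1) ≤
          ∑ j, (h k * (⌊(h k)⁻¹ * x j - s k j⌋ + s k j)) ^ 2 := by
        refine Finset.sum_le_sum fun j _ => ?_
        have h1 := (key (t := x j) (s := s k j) hk0).trans hk1
        set y := h k * (⌊(h k)⁻¹ * x j - s k j⌋ + s k j)
        have h2 : (y - x j) ^ 2 ≤ 1 := by rw [← sq_abs]; exact pow_le_one₀ (abs_nonneg _) h1
        nlinarith [sq_nonneg (2 * y - x j)]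
      rw [Finset.sum_sub_distrib, ← Finset.sum_div] at this
      simp only [Finset.sum_const, Finset.card_univ, Fintype.card_fin, nsmul_eq_mul,
        mul_one] at this
      nlinarith
    · exact (integrable_exp_neg_mul_sum_sq (half_pos hα)).const_mul _
    · refine Eventually.of_forall fun x => hlim x _ ?_
      refine tendsto_pi_nhds.2 fun j => ?_
      rw [tendsto_iff_dist_tendsto_zero]
      refine squeeze_zero' (Eventually.of_forall fun _ => dist_nonneg) ?_ hlim0
      filter_upwards [hpos] with k hk
      exact key hk
  refine hT.congr' ?_
  filter_upwards [hpos] with k hk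
  exact integral_floor_affine_eq_tsum (G k) hk (s k)

/-! ### Poisson weights: Gaussian bounds and the local limit. -/

/-- The Poisson weight `e⁻ᵗ tⁿ / n!`, multiplied by `√t`. -/
noncomputable def scaledPoisson (t : ℝ) (n : ℕ) : ℝ :=
  √t * (Real.exp (-t) * t ^ n / n.factorial)

theorem scaledPoisson_nonneg {t : ℝ} (ht : 0 ≤ t) (n : ℕ) : 0 ≤ scaledPoisson t n := by
  unfold scaledPoisson; positivity

/-- Splits off the factor that Stirling's formula cancels; what remains is the exponential of minus
a relative entropy. -/
theorem exp_neg_mul_pow_eq {t : ℝ} (ht : 0 < t) {n : ℕ} (hn : 0 < n) :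
    Real.exp (-t) * t ^ n =
      (n / Real.exp 1) ^ n * Real.exp (-(n * Real.log (n / t) - n + t)) := by
  have hn' : (0 : ℝ) < n := by exact_mod_cast hn
  have h1 : (n / Real.exp 1) ^ n = Real.exp (n * (Real.log n - 1)) := by
    rw [Real.exp_nat_mul, Real.exp_sub, Real.exp_log hn']
  have h2 : t ^ n = Real.exp (n * Real.log t) := by
    rw [Real.exp_nat_mul, Real.exp_log ht]
  rw [h1, h2, ← Real.exp_add, ← Real.exp_add, Real.log_div hn'.ne' ht.ne']
  congr 1
  ring

/-- The entropy is at least `(√n - √t)²`. Half of it is kept as the bound and the other half absorbs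
the factor `√t / √n` left by Stirling. The case `n = 0` is separate, since Stirling's lower bound is
used only for `n > 0`. -/
theorem scaledPoisson_le {t : ℝ} (ht : 0 < t) (n : ℕ) :
    scaledPoisson t n ≤ 2 * Real.exp (-(√n - √t) ^ 2 / 2) := by
  rcases Nat.eq_zero_or_pos n with rfl | hn
  · have h1 : √t ≤ 2 * Real.exp (t / 2) := by
      have := Real.add_one_le_exp (t / 2)
      nlinarith [Real.sq_sqrt ht.le, sq_nonneg (√t - 1)]
    have h2 : Real.exp (-t) = Real.exp (-(t / 2)) * Real.exp (-(t / 2)) := by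
      rw [← Real.exp_add]; ring_nf
    have h3 : Real.exp (t / 2) * Real.exp (-(t / 2)) = 1 := by
      rw [← Real.exp_add]; simp
    have h4 : -(√((0 : ℕ) : ℝ) - √t) ^ 2 / 2 = -(t / 2) := by
      simp [Real.sq_sqrt ht.le]; ring
    rw [scaledPoisson, h4, h2]
    have := mul_le_mul_of_nonneg_right h1
      (mul_nonneg (Real.exp_pos (-(t / 2))).le (Real.exp_pos (-(t / 2))).le)
    simp only [pow_zero, mul_one, Nat.factorial_zero, Nat.cast_one, div_one]
    calc _ ≤ _ := this
      _ = 2 * (Real.exp (t / 2) * Real.exp (-(t / 2))) * Real.exp (-(t / 2)) := by ring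
      _ = _ := by rw [h3, mul_one]
  · have hn' : (1 : ℝ) ≤ n := by exact_mod_cast hn
    have hq : 1 ≤ √(n : ℝ) := Real.one_le_sqrt.2 hn'
    have hq0 : 0 < √(n : ℝ) := by linarith
    have hp0 : 0 < √t := Real.sqrt_pos.2 ht
    have hpp := Real.sq_sqrt ht.le
    have hqq := Real.sq_sqrt (zero_le_one.trans hn')
    set p := √t
    set q := √(n : ℝ)
    -- This is `log x ≤ x - 1` at `x = p / q`; taking square roots first produces the square.
    have hD : (q - p) ^ 2 ≤ n * Real.log (n / t) - n + t := by
      have h1 : Real.log (n / t) = -(2 * Real.log (p / q)) := by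
        rw [← hpp, ← hqq, ← div_pow, Real.log_pow, Real.log_div hq0.ne' hp0.ne',
          Real.log_div hp0.ne' hq0.ne']
        push_cast; ring
      have h2 := Real.log_le_sub_one_of_pos (div_pos hp0 hq0)
      have h3 : (n : ℝ) * (p / q) = q * p := by rw [← hqq]; field_simp
      rw [h1]
      nlinarith
    have hS : q * (n / Real.exp 1) ^ n ≤ n.factorial := by
      refine le_trans (mul_le_mul_of_nonneg_right ?_ (by positivity))
        (Stirling.le_factorial_stirling n)
      exact Real.sqrt_le_sqrt (by nlinarith [Real.pi_gt_three])
    have hfac : (0 : ℝ) < n.factorial := by positivity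
    have hratio : p ≤ q * (2 * Real.exp ((q - p) ^ 2 / 2)) := by
      have h1 := Real.add_one_le_exp ((q - p) ^ 2 / 2)
      have h2 : p ≤ q * (2 + (q - p) ^ 2) := by
        nlinarith [sq_nonneg (q - p), sq_nonneg (p - q - 1), mul_nonneg (sub_nonneg.2 hq) (sq_nonneg (q - p))]
      exact h2.trans (mul_le_mul_of_nonneg_left (by linarith) hq0.le)
    rw [scaledPoisson, ← mul_div_assoc, div_le_iff₀ hfac, exp_neg_mul_pow_eq ht hn]
    have hE : Real.exp (-(n * Real.log (n / t) - n + t)) ≤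
        Real.exp (-(q - p) ^ 2 / 2) * Real.exp (-((q - p) ^ 2 / 2)) := by
      rw [← Real.exp_add]
      exact Real.exp_le_exp.2 (by linarith)
    have h1 : Real.exp ((q - p) ^ 2 / 2) * Real.exp (-((q - p) ^ 2 / 2)) = 1 := by
      rw [← Real.exp_add]; simp
    calc p * ((n / Real.exp 1) ^ n * Real.exp (-(n * Real.log (n / t) - n + t)))
        ≤ (q * (2 * Real.exp ((q - p) ^ 2 / 2))) * ((n / Real.exp 1) ^ n *
            (Real.exp (-(q - p) ^ 2 / 2) * Real.exp (-((q - p) ^ 2 / 2)))) := by gcongr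
      _ = 2 * Real.exp (-(q - p) ^ 2 / 2) * (q * (n / Real.exp 1) ^ n) *
          (Real.exp ((q - p) ^ 2 / 2) * Real.exp (-((q - p) ^ 2 / 2))) := by ring
      _ ≤ _ := by rw [h1, mul_one]; gcongr

/-- Since `n - t = (√n - √t)(√n + √t)` and `(√n + √t)² ≤ 2 (1 + M) t`, the bound in square roots
becomes truly Gaussian. -/
theorem scaledPoisson_le_of_le_mul {t M : ℝ} (ht : 0 < t) (hM : 0 ≤ M) {n : ℕ}
    (hn : (n : ℝ) ≤ M * t) :
    scaledPoisson t n ≤ 2 * Real.exp (-(4 * (1 + M))⁻¹ * ((n - t) ^ 2 / t)) := by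
  refine (scaledPoisson_le ht n).trans ?_
  refine mul_le_mul_of_nonneg_left (Real.exp_le_exp.2 ?_) zero_le_two
  have hpp := Real.sq_sqrt ht.le
  have hqq := Real.sq_sqrt (Nat.cast_nonneg (α := ℝ) n)
  set p := √t
  set q := √(n : ℝ)
  have h1 : ((n : ℝ) - t) ^ 2 = (q - p) ^ 2 * (q + p) ^ 2 := by rw [← hpp, ← hqq]; ring
  have h2 : (q + p) ^ 2 ≤ 2 * (1 + M) * t := by nlinarith [sq_nonneg (q - p)]
  have h3 : ((n : ℝ) - t) ^ 2 / t ≤ (q - p) ^ 2 * (2 * (1 + M)) := by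
    rw [div_le_iff₀ ht, h1, mul_assoc]
    exact mul_le_mul_of_nonneg_left h2 (sq_nonneg _)
  have h4 : (4 * (1 + M))⁻¹ * (((n : ℝ) - t) ^ 2 / t) ≤ (q - p) ^ 2 / 2 := by
    rw [inv_mul_le_iff₀ (by positivity)]
    linarith
  linarith

theorem abs_mul_log_sub_le {δ : ℝ} (hδ : |δ| ≤ 1 / 2) :
    |(1 + δ) * Real.log (1 + δ) - δ - δ ^ 2 / 2| ≤ 4 * |δ| ^ 3 := by
  have h := Real.abs_log_sub_add_sum_range_le (x := -δ) (by rw [abs_neg]; linarith) 2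
  simp only [Finset.sum_range_succ, Finset.sum_range_zero, abs_neg, sub_neg_eq_add] at h
  norm_num at h
  have h2 : |δ| ^ 3 / (1 - |δ|) ≤ 2 * |δ| ^ 3 := by
    rw [div_le_iff₀ (by linarith)]
    nlinarith [pow_nonneg (abs_nonneg δ) 3]
  set e := -δ + δ ^ 2 / 2 + Real.log (1 + δ) with he
  have h3 : (1 + δ) * Real.log (1 + δ) - δ - δ ^ 2 / 2 = (1 + δ) * e - δ ^ 3 / 2 := by
    rw [he]; ring
  have h4 : |1 + δ| ≤ 3 / 2 := by
    rw [abs_le] at hδ ⊢; constructor <;> linarith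
  calc _ = |(1 + δ) * e - δ ^ 3 / 2| := by rw [h3]
    _ ≤ |(1 + δ) * e| + |δ ^ 3 / 2| := abs_sub _ _
    _ = |1 + δ| * |e| + |δ| ^ 3 / 2 := by rw [abs_mul, abs_div, abs_pow, abs_two]
    _ ≤ 3 / 2 * (2 * |δ| ^ 3) + |δ| ^ 3 / 2 := by
      gcongr; exact h.trans h2
    _ ≤ _ := by nlinarith [pow_nonneg (abs_nonneg δ) 3]

/-- The local limit theorem for the Poisson distribution. -/
theorem tendsto_scaledPoisson {μ u : ℝ} (hμ : 0 < μ) {n : ℕ → ℕ}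
    (hn : Tendsto (fun k : ℕ => (√k)⁻¹ * ((n k : ℝ) - k * μ)) atTop (𝓝 u)) :
    Tendsto (fun k : ℕ => √(2 * Real.pi) * scaledPoisson (k * μ) (n k)) atTop
      (𝓝 (Real.exp (-(1 / 2) * (u ^ 2 / μ)))) := by
  have hsq : Tendsto (fun k : ℕ => √(k : ℝ)) atTop atTop :=
    Real.tendsto_sqrt_atTop.comp tendsto_natCast_atTop_atTop
  have hsq0 : Tendsto (fun k : ℕ => (√(k : ℝ))⁻¹) atTop (𝓝 0) := tendsto_inv_atTop_zero.comp hsq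
  have hk0 : ∀ᶠ k : ℕ in atTop, (0 : ℝ) < k := by
    filter_upwards [eventually_gt_atTop 0] with k hk
    exact_mod_cast hk
  set δ : ℕ → ℝ := fun k => (n k : ℝ) / (k * μ) - 1 with hδdef
  have hδ : Tendsto δ atTop (𝓝 0) := by
    have := (hsq0.mul hn).div_const μ
    rw [zero_mul, zero_div] at this
    refine this.congr' ?_
    filter_upwards [hk0] with k hk
    have : √(k : ℝ) * √(k : ℝ) = k := Real.mul_self_sqrt hk.le
    rw [← mul_assoc, ← mul_inv, this, hδdef]
    field_simp
  have htδ : Tendsto (fun k : ℕ => k * μ * δ k ^ 2) atTop (𝓝 (u ^ 2 / μ)) := by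
    refine ((hn.pow 2).div_const μ).congr' ?_
    filter_upwards [hk0] with k hk
    rw [mul_pow, inv_pow, Real.sq_sqrt hk.le, hδdef]
    field_simp
  have hnt : Tendsto (fun k : ℕ => (n k : ℝ) / (k * μ)) atTop (𝓝 1) := by
    have := hδ.add_const 1
    simpa [hδdef] using this
  have hnpos : ∀ᶠ k in atTop, 0 < n k := by
    filter_upwards [hk0, hnt.eventually (lt_mem_nhds zero_lt_one)] with k hk h
    by_contra h0
    simp [Nat.eq_zero_of_not_pos h0] at h
  have hninf : Tendsto n atTop atTop := by
    rw [← tendsto_natCast_atTop_iff (R := ℝ)]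
    have h1 : Tendsto (fun k : ℕ => (k : ℝ) * μ) atTop atTop :=
      tendsto_natCast_atTop_atTop.atTop_mul_const hμ
    refine (hnt.pos_mul_atTop zero_lt_one h1).congr' ?_
    filter_upwards [hk0] with k hk
    field_simp
  -- With relative deviation `δ`, the quadratic term of the entropy is `k μ δ² / 2`, which
  -- converges; the cubic error is `O((k μ δ²) |δ|)`, hence tends to `0`.
  have hD : Tendsto (fun k : ℕ => (n k : ℝ) * Real.log (n k / (k * μ)) - n k + k * μ) atTop
      (𝓝 (1 / 2 * (u ^ 2 / μ))) := by
    have herr : Tendsto (fun k : ℕ => 4 * (k * μ * δ k ^ 2) * |δ k|) atTop (𝓝 0) := by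
      have := (htδ.const_mul 4).mul hδ.abs
      simpa using this
    have hmain := htδ.const_mul (1 / 2)
    rw [← add_zero (1 / 2 * (u ^ 2 / μ))]
    have hz : Tendsto (fun k : ℕ => (n k : ℝ) * Real.log (n k / (k * μ)) - n k + k * μ
        - 1 / 2 * (k * μ * δ k ^ 2)) atTop (𝓝 0) := by
      refine squeeze_zero_norm' ?_ herr
      filter_upwards [hk0, (tendsto_order.1 hδ.abs).2 (1 / 2) (by simp)] with k hk hd
      have h1 := abs_mul_log_sub_le hd.le
      have ht : 0 < k * μ := mul_pos hk hμ
      have h2 : 1 + δ k = n k / (k * μ) := by simp [hδdef]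
      have h3 : (n k : ℝ) = k * μ * (1 + δ k) := by rw [h2]; field_simp
      rw [h2] at h1
      have h4 : (n k : ℝ) * Real.log (n k / (k * μ)) - n k + k * μ
          - 1 / 2 * (k * μ * δ k ^ 2) = k * μ * ((n k / (k * μ)) * Real.log (n k / (k * μ))
            - δ k - δ k ^ 2 / 2) := by
        generalize Real.log (n k / (k * μ)) = ℓ
        rw [← h2, h3]; ring
      rw [h4, Real.norm_eq_abs, abs_mul, abs_of_pos ht]
      calc _ ≤ k * μ * (4 * |δ k| ^ 3) := mul_le_mul_of_nonneg_left h1 ht.le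
        _ = _ := by rw [← sq_abs (δ k)]; ring
    refine (hmain.add hz).congr fun k => ?_
    ring
  have hst : Tendsto (fun k : ℕ => √(2 * n k * Real.pi) * (n k / Real.exp 1) ^ n k /
      (n k).factorial) atTop (𝓝 1) := by
    have h1 := (Asymptotics.isEquivalent_iff_tendsto_one (Eventually.of_forall fun m => by
      show ((m.factorial : ℕ) : ℝ) ≠ 0; positivity)).1
      Stirling.factorial_isEquivalent_stirling.symm
    exact h1.comp hninf
  have hr : Tendsto (fun k : ℕ => (√((n k : ℝ) / (k * μ)))⁻¹) atTop (𝓝 1) := by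
    have := (hnt.sqrt).inv₀ (by simp)
    simpa using this
  have hall := (hst.mul hr).mul (hD.neg.rexp)
  rw [one_mul, one_mul, ← neg_mul] at hall
  refine hall.congr' ?_
  filter_upwards [hk0, hnpos] with k hk hnk
  have ht : 0 < k * μ := mul_pos hk hμ
  have hn0 : (0 : ℝ) < n k := by exact_mod_cast hnk
  rw [scaledPoisson, exp_neg_mul_pow_eq ht hnk]
  generalize Real.exp (-(_)) = e
  have h1 : √(2 * n k * Real.pi) = √(2 * Real.pi) * √(n k : ℝ) := by
    rw [← Real.sqrt_mul (by positivity)]; ring_nf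
  rw [h1, Real.sqrt_div hn0.le]
  have := (Real.sqrt_pos.2 hn0).ne'
  field_simp

/-! ### Integer points of rational subspaces. -/

theorem pairing_add {n : ℕ} (w : Fin n → ℤ) (x y : E n) :
    pairing w (x + y) = pairing w x + pairing w y := by
  simp [pairing, mul_add, Finset.sum_add_distrib]

theorem pairing_smul {n : ℕ} (w : Fin n → ℤ) (c : ℝ) (x : E n) :
    pairing w (c • x) = c * pairing w x := by
  simp [pairing, Finset.mul_sum, mul_left_comm]

/-- The pairing with a fixed integer vector, as a linear functional. -/
noncomputable def pairingL {n : ℕ} (w : Fin n → ℤ) : E n →ₗ[ℝ] ℝ where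
  toFun := pairing w
  map_add' := pairing_add w
  map_smul' := pairing_smul w

@[simp] theorem pairingL_apply {n : ℕ} (w : Fin n → ℤ) (x : E n) : pairingL w x = pairing w x :=
  rfl

theorem pairing_sub {n : ℕ} (w : Fin n → ℤ) (x y : E n) :
    pairing w (x - y) = pairing w x - pairing w y :=
  map_sub (pairingL w) x y

theorem continuous_pairing {n : ℕ} (w : Fin n → ℤ) : Continuous (pairing (n := n) w) :=
  (pairingL w).continuous_of_finiteDimensional

theorem pairing_latticePoint {n : ℕ} (w z : Fin n → ℤ) :
    pairing w (latticePoint z) = ((∑ j, w j * z j : ℤ) : ℝ) := by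
  simp [pairing, latticePoint]

@[simp] theorem latticePoint_apply {n : ℕ} (z : Fin n → ℤ) (j : Fin n) :
    latticePoint z j = z j := rfl

theorem latticePoint_add {n : ℕ} (z w : Fin n → ℤ) :
    latticePoint (z + w) = latticePoint z + latticePoint w := by
  ext j; simp

theorem latticePoint_sub {n : ℕ} (z w : Fin n → ℤ) :
    latticePoint (z - w) = latticePoint z - latticePoint w := by
  ext j; simp

theorem latticePoint_injective {n : ℕ} : Function.Injective (latticePoint (n := n)) := by
  intro z w h
  funext j
  have := congrArg (fun x : E n => x j) h
  simpa using this

theorem one_le_dist_latticePoint {n : ℕ} {z w : Fin n → ℤ} (h : z ≠ w) :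
    1 ≤ dist (latticePoint z) (latticePoint w) := by
  obtain ⟨j, hj⟩ := Function.ne_iff.1 h
  have h1 := PiLp.norm_apply_le (latticePoint z - latticePoint w) j
  rw [dist_eq_norm]
  refine le_trans ?_ h1
  rw [PiLp.sub_apply, latticePoint_apply, latticePoint_apply, Real.norm_eq_abs]
  exact_mod_cast Int.one_le_abs (sub_ne_zero.2 hj)

/-- The common kernel of the functionals `⟨vᵢ, ·⟩`, `i ∈ J`. -/
noncomputable def commonKernel {n r : ℕ} (v : Fin r → Fin n → ℤ) (J : Set (Fin r)) :
    Submodule ℝ (E n) :=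
  ⨅ i ∈ J, LinearMap.ker (pairingL (v i))

theorem mem_commonKernel {n r : ℕ} {v : Fin r → Fin n → ℤ} {J : Set (Fin r)} {x : E n} :
    x ∈ commonKernel v J ↔ ∀ i ∈ J, pairing (v i) x = 0 := by
  simp [commonKernel]

/-- The integer points of the common kernel. -/
noncomputable def kernelLattice {n r : ℕ} (v : Fin r → Fin n → ℤ) (J : Set (Fin r)) :
    Submodule ℤ (commonKernel v J) :=
  AddSubgroup.toIntSubmodule
    { carrier := {y | ∃ z : Fin n → ℤ, latticePoint z = y}
      zero_mem' := ⟨0, by ext j; simp⟩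
      add_mem' := by
        rintro _ _ ⟨z, hz⟩ ⟨w, hw⟩
        exact ⟨z + w, by rw [latticePoint_add, hz, hw]; rfl⟩
      neg_mem' := by
        rintro y ⟨z, hz⟩
        exact ⟨-z, by rw [Submodule.coe_neg, ← hz]; ext j; simp⟩ }

instance discreteTopology_kernelLattice {n r : ℕ} (v : Fin r → Fin n → ℤ) (J : Set (Fin r)) :
    DiscreteTopology (kernelLattice v J) := by
  refine DiscreteTopology.of_forall_le_dist zero_lt_one ?_
  rintro ⟨x, z, hz⟩ ⟨y, w, hw⟩ hxy
  have : dist (latticePoint z) (latticePoint w) = dist (x : E n) y := by rw [hz, hw]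
  change 1 ≤ dist (x : E n) y
  rw [← this]
  refine one_le_dist_latticePoint ?_
  rintro rfl
  exact hxy (Subtype.ext (Subtype.ext (hz.symm.trans hw)))

theorem exists_int_multiple {n : ℕ} (q : Fin n → ℚ) :
    ∃ N : ℤ, N ≠ 0 ∧ ∃ z : Fin n → ℤ, ∀ j, (z j : ℚ) = N * q j := by
  obtain ⟨N, hN⟩ := IsLocalization.exist_integer_multiples_of_finite (nonZeroDivisors ℤ) q
  choose z hz using hN
  refine ⟨N, nonZeroDivisors.coe_ne_zero N, z, fun j => ?_⟩
  simpa [Submonoid.smul_def] using hz j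

/-- A rational subspace is spanned by its integer points. -/
theorem span_kernelLattice {n r : ℕ} (v : Fin r → Fin n → ℤ) (J : Set (Fin r)) :
    Submodule.span ℝ (kernelLattice v J : Set (commonKernel v J)) = ⊤ := by
  rw [eq_top_iff]
  rintro ⟨x, hx⟩ -
  rw [mem_commonKernel] at hx
  -- Expanding the coordinates of `x` in a `ℚ`-basis of `ℝ` writes `x` as a real combination of
  -- rational vectors. The equations have integer coefficients, so each of these vectors satisfies
  -- them; clearing denominators makes them integral.
  let B := Module.Basis.ofVectorSpace ℚ ℝ
  choose N hN z hz using fun β => exists_int_multiple (fun j => B.repr (x j) β)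
  have hker : ∀ β, latticePoint (z β) ∈ commonKernel v J := by
    intro β
    rw [mem_commonKernel]
    intro i hi
    have h1 : B.repr (pairing (v i) x) β = 0 := by rw [hx i hi]; simp
    have h2 : B.repr (pairing (v i) x) β = ∑ j, (v i j : ℚ) * B.repr (x j) β := by
      have : pairing (v i) x = ∑ j, (v i j : ℚ) • x j := by
        simp [pairing, Rat.smul_def]
      rw [this]
      simp [Finsupp.finsetSum_apply]
    rw [pairing_latticePoint, Int.cast_eq_zero, ← Int.cast_eq_zero (α := ℚ)]
    push_cast
    rw [Finset.sum_congr rfl fun j _ => show (v i j : ℚ) * z β j =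
      N β * (v i j * B.repr (x j) β) by rw [hz]; ring, ← Finset.mul_sum, ← h2, h1, mul_zero]
  classical
  let S := Finset.univ.biUnion fun j => (B.repr (x j)).support
  have hsum : (⟨x, mem_commonKernel.2 hx⟩ : commonKernel v J) =
      ∑ β ∈ S, ((N β : ℝ)⁻¹ * B β) • (⟨latticePoint (z β), hker β⟩ : commonKernel v J) := by
    refine Subtype.ext ?_
    ext j
    simp only [Submodule.coe_sum, Submodule.coe_smul, WithLp.ofLp_sum,
      Finset.sum_apply, WithLp.ofLp_smul, Pi.smul_apply, latticePoint_apply, smul_eq_mul]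
    have h1 := B.linearCombination_repr (x j)
    rw [Finsupp.linearCombination_apply, Finsupp.sum_of_support_subset (s := S) _
      (Finset.subset_biUnion_of_mem (fun j => (B.repr (x j)).support) (Finset.mem_univ j)) _
      (by simp)] at h1
    rw [← h1]
    refine Finset.sum_congr rfl fun β _ => ?_
    have h2 : (z β j : ℝ) = N β * (B.repr (x j) β : ℝ) := by exact_mod_cast hz β j
    have h3 : (N β : ℝ) ≠ 0 := by exact_mod_cast hN β
    rw [h2, Rat.smul_def]
    field_simp
  rw [hsum]
  exact Submodule.sum_mem _ fun β _ =>
    Submodule.smul_mem _ _ (Submodule.subset_span ⟨z β, rfl⟩)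

/-- The integer points form a discrete, spanning subgroup of the kernel, so a `ℤ`-basis of them is
also an `ℝ`-basis of the kernel. -/
theorem exists_lattice_parametrization {n r : ℕ} (v : Fin r → Fin n → ℤ) (J : Set (Fin r)) :
    ∃ (d : ℕ) (Φ : (Fin d → ℝ) →ₗ[ℝ] E n), Function.Injective Φ ∧
      (∀ x, x ∈ commonKernel v J ↔ ∃ t, Φ t = x) ∧
      (∀ z, latticePoint z ∈ commonKernel v J →
        ∃ w : Fin d → ℤ, Φ (fun j => w j) = latticePoint z) ∧
      ∀ w : Fin d → ℤ, ∃ z, Φ (fun j => w j) = latticePoint z := by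
  have hZ : IsZLattice ℝ (kernelLattice v J) := ⟨span_kernelLattice v J⟩
  have := ZLattice.module_free ℝ (kernelLattice v J)
  have := ZLattice.module_finite ℝ (kernelLattice v J)
  let b := Module.finBasis ℤ (kernelLattice v J)
  let B := b.ofZLatticeBasis ℝ (kernelLattice v J)
  have hB : ∀ w : Fin (Module.finrank ℤ (kernelLattice v J)) → ℤ,
      B.equivFun.symm (fun j => (w j : ℝ)) = (b.equivFun.symm w : kernelLattice v J) := by
    intro w
    rw [Module.Basis.equivFun_symm_apply, Module.Basis.equivFun_symm_apply]
    simp only [B, Module.Basis.ofZLatticeBasis_apply, Submodule.coe_sum, Submodule.coe_smul]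
    exact Finset.sum_congr rfl fun j _ => Int.cast_smul_eq_zsmul ℝ _ _
  refine ⟨_, (commonKernel v J).subtype ∘ₗ B.equivFun.symm.toLinearMap, ?_, ?_, ?_, ?_⟩
  · exact Subtype.val_injective.comp B.equivFun.symm.injective
  · intro x
    constructor
    · intro hx
      exact ⟨B.equivFun ⟨x, hx⟩, by simp⟩
    · rintro ⟨t, rfl⟩
      exact (B.equivFun.symm t).2
  · intro z hz
    refine ⟨b.equivFun ⟨⟨latticePoint z, hz⟩, z, rfl⟩, ?_⟩
    have := hB (b.equivFun ⟨⟨latticePoint z, hz⟩, z, rfl⟩)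
    rw [LinearEquiv.symm_apply_apply] at this
    exact congrArg Subtype.val this
  · intro w
    obtain ⟨z, hz⟩ := (b.equivFun.symm w).2
    exact ⟨z, (congrArg Subtype.val (hB w)).trans hz.symm⟩

/-! ### The polyhedron, its direction space and the minimiser. -/

variable {n r : ℕ} {v : Fin r → Fin n → ℤ} {a : Fin r → ℤ}

theorem convex_polyhedron : Convex ℝ (polyhedron v a) := by
  intro x hx y hy s t hs ht hst i
  rw [pairing_add, pairing_smul, pairing_smul]
  have h1 := mul_nonneg hs (hx i)
  have h2 := mul_nonneg ht (hy i)
  have h3 : (a i : ℝ) = s * a i + t * a i := by rw [← add_mul, hst, one_mul]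
  linarith

/-- A form constant on `P` takes its value at the point where `P` touches the hyperplane. -/
theorem eq_zero_of_notMem_varyingIndices
    (htouch : ∀ i, (hyperplane v a i ∩ polyhedron v a).Nonempty) {i : Fin r}
    (hi : i ∉ varyingIndices v a) {x : E n} (hx : x ∈ polyhedron v a) :
    pairing (v i) x + a i = 0 := by
  obtain ⟨y, hy, hyP⟩ := htouch i
  have : pairing (v i) x = pairing (v i) y := by
    by_contra h
    exact hi (by simp only [varyingIndices, Finset.mem_filter, Finset.mem_univ, true_and]
                 exact ⟨x, hx, y, hyP, h⟩)
  rw [this]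
  exact hy

theorem exists_mem_forall_varyingIndices_pos (hne : (polyhedron v a).Nonempty) :
    ∃ x ∈ polyhedron v a, ∀ i ∈ varyingIndices v a, 0 < pairing (v i) x + a i := by
  suffices h : ∀ s ⊆ varyingIndices v a, ∃ x ∈ polyhedron v a,
      ∀ i ∈ s, 0 < pairing (v i) x + a i from h _ subset_rfl
  intro s
  induction s using Finset.induction_on with
  | empty =>
    obtain ⟨x, hx⟩ := hne
    exact fun _ => ⟨x, hx, by simp⟩
  | insert i s _ ih =>
    intro hs
    obtain ⟨x, hx, hxs⟩ := ih ((Finset.subset_insert i s).trans hs)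
    obtain ⟨y, hy, hyi⟩ : ∃ y ∈ polyhedron v a, 0 < pairing (v i) y + a i := by
      have hi := hs (Finset.mem_insert_self i s)
      simp only [varyingIndices, Finset.mem_filter, Finset.mem_univ, true_and] at hi
      obtain ⟨y, hy, z, hz, hyz⟩ := hi
      rcases lt_or_gt_of_ne hyz with h | h
      · exact ⟨z, hz, by linarith [hy i]⟩
      · exact ⟨y, hy, by linarith [hz i]⟩
    refine ⟨(1 / 2 : ℝ) • x + (1 / 2 : ℝ) • y,
      convex_polyhedron hx hy (by norm_num) (by norm_num) (by norm_num), fun j hj => ?_⟩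
    rw [pairing_add, pairing_smul, pairing_smul]
    rcases Finset.mem_insert.1 hj with rfl | hj
    · linarith [hx j]
    · linarith [hxs j hj, hy j]

/-- The logarithm of the potential. -/
noncomputable def logPotential (v : Fin r → Fin n → ℤ) (a : Fin r → ℤ) (x : E n) : ℝ :=
  ∑ i, (pairing (v i) x + a i) * Real.log (pairing (v i) x + a i)

theorem potential_eq_exp {x : E n} (hx : x ∈ polyhedron v a) :
    potential v a x = Real.exp (logPotential v a x) := by
  rw [potential, logPotential, Real.exp_sum]
  refine Finset.prod_congr rfl fun i _ => ?_
  rcases (hx i).eq_or_lt with h | h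
  · simp [← h]
  · rw [Real.rpow_def_of_pos h, mul_comm]

theorem continuous_logPotential : Continuous (logPotential v a) :=
  continuous_finsetSum _ fun i _ =>
    Real.continuous_mul_log.comp ((continuous_pairing (v i)).add continuous_const)

theorem isMinOn_potential_iff {m : E n} (hm : m ∈ polyhedron v a) :
    IsMinOn (potential v a) (polyhedron v a) m ↔
      ∀ x ∈ polyhedron v a, logPotential v a m ≤ logPotential v a x := by
  refine forall₂_congr fun x hx => ?_
  rw [Set.mem_ofPred_eq, potential_eq_exp hm, potential_eq_exp hx, Real.exp_le_exp]

/-- The slope of `t log t` at `0` is `-∞`. If an entry vanished at `m`, moving a fraction `ε`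
towards a point where it is positive would change the potential's logarithm by at most `ε (C + b log
ε)`, negative for small `ε`. -/
theorem pos_of_isMinOn {m : E n} (hm : m ∈ polyhedron v a)
    (hmin : ∀ x ∈ polyhedron v a, logPotential v a m ≤ logPotential v a x) {i : Fin r}
    (hi : i ∈ varyingIndices v a) : 0 < pairing (v i) m + a i := by
  refine (hm i).lt_of_ne' fun h0 => ?_
  obtain ⟨x, hx, hxpos⟩ := exists_mem_forall_varyingIndices_pos ⟨m, hm⟩
  set b := pairing (v i) x + a i with hb
  have hbpos : 0 < b := hxpos i hi
  set C := ∑ j, ((pairing (v j) x + a j) * Real.log (pairing (v j) x + a j) -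
    (pairing (v j) m + a j) * Real.log (pairing (v j) m + a j)) with hC
  have key : ∀ ε : ℝ, 0 < ε → ε ≤ 1 → 0 ≤ C + b * Real.log ε := by
    intro ε hε hε1
    have hmem : (1 - ε) • m + ε • x ∈ polyhedron v a :=
      convex_polyhedron hm hx (by linarith) hε.le (by ring)
    have hval : ∀ j, pairing (v j) ((1 - ε) • m + ε • x) + a j =
        (1 - ε) * (pairing (v j) m + a j) + ε * (pairing (v j) x + a j) := by
      intro j
      rw [pairing_add, pairing_smul, pairing_smul]; ring
    have hle := sub_nonneg.2 (hmin _ hmem)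
    rw [logPotential, logPotential, ← Finset.sum_sub_distrib] at hle
    have hterm : ∑ j, ((pairing (v j) ((1 - ε) • m + ε • x) + a j) *
        Real.log (pairing (v j) ((1 - ε) • m + ε • x) + a j) -
        (pairing (v j) m + a j) * Real.log (pairing (v j) m + a j)) ≤
        ∑ j, (ε * ((pairing (v j) x + a j) * Real.log (pairing (v j) x + a j) -
          (pairing (v j) m + a j) * Real.log (pairing (v j) m + a j)) +
          if j = i then ε * (b * Real.log ε) else 0) := by
      refine Finset.sum_le_sum fun j _ => ?_
      rw [hval]
      split_ifs with hj
      · subst hj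
        rw [h0, ← hb, mul_zero, zero_add, Real.log_mul hε.ne' hbpos.ne']
        apply le_of_eq; ring
      · have := Real.convexOn_mul_log.2 (hm j) (hx j) (sub_nonneg.2 hε1) hε.le (by ring)
        simp only [smul_eq_mul] at this
        linarith
    rw [Finset.sum_add_distrib, ← Finset.mul_sum, ← hC, Finset.sum_ite_eq' Finset.univ i,
      if_pos (Finset.mem_univ i), ← mul_add] at hterm
    exact nonneg_of_mul_nonneg_right (hle.trans hterm) hε
  -- This `ε` makes `b log ε = -(|C| + 1)`.
  have h1 := key (Real.exp (-(|C| + 1) / b)) (Real.exp_pos _)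
    (Real.exp_le_one_iff.2 (div_nonpos_of_nonpos_of_nonneg (by linarith [abs_nonneg C]) hbpos.le))
  rw [Real.log_exp, mul_div_cancel₀ _ hbpos.ne'] at h1
  linarith [le_abs_self C]

theorem eventually_add_smul_mem {m : E n} (hm : m ∈ polyhedron v a)
    (hpos : ∀ i ∈ varyingIndices v a, 0 < pairing (v i) m + a i) {y : E n}
    (hy : y ∈ commonKernel v {i | i ∉ varyingIndices v a}) :
    ∀ᶠ ε : ℝ in 𝓝 0, m + ε • y ∈ polyhedron v a := by
  have h : ∀ i, ∀ᶠ ε : ℝ in 𝓝 0, 0 ≤ pairing (v i) (m + ε • y) + a i := by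
    intro i
    by_cases hi : i ∈ varyingIndices v a
    · have hc : Continuous fun ε : ℝ => pairing (v i) (m + ε • y) + a i :=
        ((continuous_pairing (v i)).comp (by fun_prop)).add continuous_const
      have := hc.tendsto 0
      simp only [zero_smul, add_zero] at this
      exact (this.eventually (lt_mem_nhds (hpos i hi))).mono fun _ => le_of_lt
    · refine Eventually.of_forall fun ε => ?_
      rw [pairing_add, pairing_smul, mem_commonKernel.1 hy i hi, mul_zero, add_zero]
      exact hm i
  filter_upwards [eventually_all.2 h] with ε hε using hε

/-- From a point with all varying entries positive, a small step along any vector of the kernel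
stays in `P`. -/
theorem mem_directionSpace_iff (htouch : ∀ i, (hyperplane v a i ∩ polyhedron v a).Nonempty)
    (hne : (polyhedron v a).Nonempty) {y : E n} :
    y ∈ directionSpace v a ↔ y ∈ commonKernel v {i | i ∉ varyingIndices v a} := by
  constructor
  · suffices h : directionSpace v a ≤ commonKernel v {i | i ∉ varyingIndices v a} from fun hy => h hy
    rw [directionSpace, vectorSpan, Submodule.span_le]
    rintro _ ⟨x, hx, z, hz, rfl⟩
    refine mem_commonKernel.2 fun i hi => ?_
    have h1 := eq_zero_of_notMem_varyingIndices htouch hi hx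
    have h2 := eq_zero_of_notMem_varyingIndices htouch hi hz
    change pairing (v i) (x - z) = 0
    rw [pairing_sub]
    linarith
  · intro hy
    obtain ⟨m, hm, hpos⟩ := exists_mem_forall_varyingIndices_pos hne
    have h1 := eventually_add_smul_mem hm hpos hy
    obtain ⟨ε, hε, hε0⟩ := ((h1.filter_mono nhdsWithin_le_nhds).and
      (self_mem_nhdsWithin (a := (0 : ℝ)) (s := Set.Ioi 0))).exists
    have h2 := vsub_mem_vectorSpan ℝ hε hm
    rw [vsub_eq_sub, add_sub_cancel_left] at h2
    have h3 := Submodule.smul_mem _ ε⁻¹ h2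
    rwa [smul_smul, inv_mul_cancel₀ (ne_of_gt hε0), one_smul] at h3

theorem mem_intrinsicInterior_of_pos
    (htouch : ∀ i, (hyperplane v a i ∩ polyhedron v a).Nonempty)
    {m : E n} (hm : m ∈ polyhedron v a)
    (hpos : ∀ i ∈ varyingIndices v a, 0 < pairing (v i) m + a i) :
    m ∈ intrinsicInterior ℝ (polyhedron v a) := by
  rw [mem_intrinsicInterior]
  refine ⟨⟨m, subset_affineSpan ℝ _ hm⟩, ?_, rfl⟩
  rw [mem_interior]
  refine ⟨{y | ∀ i ∈ varyingIndices v a, 0 < pairing (v i) (y : E n) + a i}, ?_, ?_, hpos⟩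
  · rintro ⟨y, hy⟩ hypos i
    by_cases hi : i ∈ varyingIndices v a
    · exact (hypos i hi).le
    · have h1 : y - m ∈ directionSpace v a := by
        rw [directionSpace, ← direction_affineSpan]
        exact AffineSubspace.vsub_mem_direction hy (subset_affineSpan ℝ _ hm)
      have h2 := mem_commonKernel.1 ((mem_directionSpace_iff htouch ⟨m, hm⟩).1 h1) i hi
      rw [pairing_sub, sub_eq_zero] at h2
      rw [h2]
      exact hm i
  · simp only [Set.ofPred_forall]
    refine isOpen_biInter_finset fun i _ => ?_
    exact isOpen_lt continuous_const
      (((continuous_pairing (v i)).comp continuous_subtype_val).add continuous_const)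

/-- A minimiser exists by compactness and lies in the relative interior by `pos_of_isMinOn`, so the
`epsilon` in `minPoint` is a genuine choice. -/
theorem minPoint_spec (hcompact : IsCompact (polyhedron v a))
    (htouch : ∀ i, (hyperplane v a i ∩ polyhedron v a).Nonempty)
    (hne : (polyhedron v a).Nonempty) :
    minPoint v a ∈ polyhedron v a ∧
      ∀ x ∈ polyhedron v a, logPotential v a (minPoint v a) ≤ logPotential v a x := by
  obtain ⟨m, hm, hmin⟩ := hcompact.exists_isMinOn hne continuous_logPotential.continuousOn
  have h : ∃ m, m ∈ intrinsicInterior ℝ (polyhedron v a) ∧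
      IsMinOn (potential v a) (polyhedron v a) m :=
    ⟨m, mem_intrinsicInterior_of_pos htouch hm fun i hi => pos_of_isMinOn hm hmin hi,
      (isMinOn_potential_iff hm).2 hmin⟩
  have hs := Classical.epsilon_spec h
  have hmem : minPoint v a ∈ polyhedron v a := intrinsicInterior_subset hs.1
  exact ⟨hmem, (isMinOn_potential_iff hmem).1 hs.2⟩

theorem sum_pairing_eq_zero (hsum : ∑ i, v i = 0) (x : E n) : ∑ i, pairing (v i) x = 0 := by
  simp only [pairing]
  rw [Finset.sum_comm]
  refine Finset.sum_eq_zero fun j _ => ?_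
  rw [← Finset.sum_mul, ← Int.cast_sum]
  have := congrFun hsum j
  rw [Finset.sum_apply] at this
  simp [this]

theorem sum_varyingIndices_pairing (hsum : ∑ i, v i = 0) {y : E n}
    (hy : y ∈ commonKernel v {i | i ∉ varyingIndices v a}) :
    ∑ i ∈ varyingIndices v a, pairing (v i) y = 0 := by
  rw [← sum_pairing_eq_zero hsum y]
  exact Finset.sum_subset (Finset.subset_univ _) fun i _ hi => mem_commonKernel.1 hy i hi

/-- The first order condition at a minimiser of the potential. -/
theorem sum_pairing_mul_log_eq_zero
    (htouch : ∀ i, (hyperplane v a i ∩ polyhedron v a).Nonempty)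
    (hsum : ∑ i, v i = 0) {m : E n} (hm : m ∈ polyhedron v a)
    (hmin : ∀ x ∈ polyhedron v a, logPotential v a m ≤ logPotential v a x) {y : E n}
    (hy : y ∈ commonKernel v {i | i ∉ varyingIndices v a}) :
    ∑ i ∈ varyingIndices v a, pairing (v i) y * Real.log (pairing (v i) m + a i) = 0 := by
  have hpos : ∀ i ∈ varyingIndices v a, 0 < pairing (v i) m + a i :=
    fun i hi => pos_of_isMinOn hm hmin hi
  set g : ℝ → ℝ := fun ε => ∑ i ∈ varyingIndices v a,
    (pairing (v i) m + a i + ε * pairing (v i) y) *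
      Real.log (pairing (v i) m + a i + ε * pairing (v i) y) with hg
  have hval : ∀ ε, logPotential v a (m + ε • y) = g ε := by
    intro ε
    rw [logPotential, hg]
    refine (Finset.sum_subset (Finset.subset_univ (varyingIndices v a)) fun i _ hi => ?_).symm.trans
      (Finset.sum_congr rfl fun i _ => ?_)
    · have h1 := eq_zero_of_notMem_varyingIndices htouch hi hm
      rw [pairing_add, pairing_smul, mem_commonKernel.1 hy i hi, mul_zero, add_zero, h1, zero_mul]
    · rw [pairing_add, pairing_smul, add_right_comm]
  have hloc : IsLocalMin g 0 := by
    filter_upwards [eventually_add_smul_mem hm hpos hy] with ε hε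
    have := hmin _ hε
    rw [hval] at this
    rwa [← hval 0, zero_smul, add_zero]
  have hder : HasDerivAt g (∑ i ∈ varyingIndices v a,
      (Real.log (pairing (v i) m + a i) + 1) * pairing (v i) y) 0 := by
    refine HasDerivAt.fun_sum fun i hi => ?_
    have h1 : HasDerivAt (fun ε : ℝ => pairing (v i) m + a i + ε * pairing (v i) y)
        (pairing (v i) y) 0 := by
      simpa using ((hasDerivAt_id (0 : ℝ)).mul_const (pairing (v i) y)).const_add
        (pairing (v i) m + a i)
    have h2 := Real.hasDerivAt_mul_log (x := pairing (v i) m + a i + 0 * pairing (v i) y)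
      (by simpa using (hpos i hi).ne')
    have := h2.comp (0 : ℝ) h1
    rw [zero_mul, add_zero] at this
    exact this
  have h0 := hloc.hasDerivAt_eq_zero hder
  simp only [add_mul, one_mul, Finset.sum_add_distrib] at h0
  -- The `1` in the derivative `log t + 1` contributes nothing because the pairings sum to zero.
  rw [sum_varyingIndices_pairing hsum hy, add_zero] at h0
  rw [← h0]
  exact Finset.sum_congr rfl fun i _ => mul_comm _ _

/-- Otherwise `P` would contain a ray in direction `y`. -/
theorem eq_zero_of_forall_pairing_eq_zero (hcompact : IsCompact (polyhedron v a))
    (hne : (polyhedron v a).Nonempty) {y : E n} (hy : ∀ i, pairing (v i) y = 0) : y = 0 := by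
  obtain ⟨x, hx⟩ := hne
  obtain ⟨R, hR⟩ := hcompact.isBounded.exists_norm_le
  by_contra hy0
  have hy1 : 0 < ‖y‖ := norm_pos_iff.2 hy0
  set t := (R + ‖x‖ + 1) / ‖y‖ with ht
  have hR0 : 0 ≤ R := (norm_nonneg x).trans (hR x hx)
  have ht0 : 0 ≤ t := by positivity
  have h1 : x + t • y ∈ polyhedron v a := by
    intro i
    rw [pairing_add, pairing_smul, hy i, mul_zero, add_zero]
    exact hx i
  have h2 := hR _ h1
  have h3 : ‖t • y‖ = R + ‖x‖ + 1 := by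
    rw [norm_smul, Real.norm_of_nonneg ht0, ht, div_mul_cancel₀ _ hy1.ne']
  have h4 := norm_sub_le (x + t • y) x
  rw [add_sub_cancel_left] at h4
  linarith

/-! ### Multinomial coefficients on dilates as Poisson products. -/

theorem mem_polyhedron_dilate_iff {k : ℕ} (hk : 0 < k) {x : E n} :
    x ∈ polyhedron v (dilate k a) ↔ (k : ℝ)⁻¹ • x ∈ polyhedron v a := by
  have hk' : (0 : ℝ) < k := by exact_mod_cast hk
  refine forall_congr' fun i => ?_
  have : pairing (v i) x + ((dilate k a i : ℤ) : ℝ) =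
      k * (pairing (v i) ((k : ℝ)⁻¹ • x) + a i) := by
    rw [pairing_smul, dilate]; push_cast; field_simp
  rw [this, mul_nonneg_iff_of_pos_left hk']

theorem finite_latticePoints_dilate (hcompact : IsCompact (polyhedron v a)) {k : ℕ} (hk : 0 < k) :
    (latticePoints v (dilate k a)).Finite := by
  have hk' : (0 : ℝ) < k := by exact_mod_cast hk
  obtain ⟨R, hR⟩ := hcompact.isBounded.exists_norm_le
  have hfin : (Metric.closedBall (0 : Fin n → ℤ) (k * R)).Finite :=
    (isCompact_closedBall (0 : Fin n → ℤ) _).finite_of_discrete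
  refine hfin.subset fun z hz => ?_
  have h1 := hR _ ((mem_polyhedron_dilate_iff hk).1 hz)
  rw [norm_smul, norm_inv, Real.norm_of_nonneg hk'.le, inv_mul_le_iff₀ hk'] at h1
  rw [mem_closedBall_zero_iff, pi_norm_le_iff_of_nonneg ((norm_nonneg _).trans h1)]
  intro j
  refine le_trans ?_ h1
  rw [← Int.norm_cast_real]
  exact PiLp.norm_apply_le (latticePoint z) j

/-- The product of the scaled Poisson weights with means `k (⟨vᵢ, m_a⟩ + aᵢ)`, `i ∈ I_a`. -/
noncomputable def poissonProd (v : Fin r → Fin n → ℤ) (a : Fin r → ℤ) (k : ℕ)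
    (z : Fin n → ℤ) : ℝ :=
  ∏ i ∈ varyingIndices v a, √(2 * Real.pi) *
    scaledPoisson (k * (pairing (v i) (minPoint v a) + a i))
      (∑ j, v i j * z j + dilate k a i).toNat

theorem toNat_cast_eq {b : Fin r → ℤ} {z : Fin n → ℤ} {i : Fin r}
    (hz : 0 ≤ pairing (v i) (latticePoint z) + b i) :
    (((∑ j, v i j * z j + b i).toNat : ℕ) : ℝ) = pairing (v i) (latticePoint z) + b i := by
  rw [pairing_latticePoint, ← Int.cast_add] at hz ⊢
  have := Int.toNat_of_nonneg (Int.cast_nonneg_iff.1 hz)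
  exact_mod_cast this

theorem pairing_add_dilate_eq {k : ℕ} (hk : 0 < k) (i : Fin r) (x : E n) :
    pairing (v i) x + dilate k a i = k * (pairing (v i) (minPoint v a) + a i) +
      √k * pairing (v i) (rescale v a k x) := by
  have hk' : (0 : ℝ) < √k := Real.sqrt_pos.2 (by exact_mod_cast hk)
  rw [rescale, pairing_smul, pairing_sub, pairing_smul, dilate, mul_inv_cancel_left₀ hk'.ne']
  push_cast
  ring

theorem dilate_eq_zero_of_notMem_varyingIndices
    (htouch : ∀ i, (hyperplane v a i ∩ polyhedron v a).Nonempty) {k : ℕ} (hk : 0 < k) {i : Fin r}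
    (hi : i ∉ varyingIndices v a) {x : E n} (hx : x ∈ polyhedron v (dilate k a)) :
    pairing (v i) x + dilate k a i = 0 := by
  have h := eq_zero_of_notMem_varyingIndices htouch hi ((mem_polyhedron_dilate_iff hk).1 hx)
  have hk' : (0 : ℝ) < k := by exact_mod_cast hk
  rw [pairing_smul] at h
  rw [dilate]
  push_cast
  field_simp at h
  linarith

theorem rescale_mem_commonKernel
    (htouch : ∀ i, (hyperplane v a i ∩ polyhedron v a).Nonempty)
    (hm : minPoint v a ∈ polyhedron v a) {k : ℕ} (hk : 0 < k) {x : E n}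
    (hx : x ∈ polyhedron v (dilate k a)) :
    rescale v a k x ∈ commonKernel v {i | i ∉ varyingIndices v a} := by
  refine mem_commonKernel.2 fun i hi => ?_
  have h1 := dilate_eq_zero_of_notMem_varyingIndices htouch hk hi hx
  rw [pairing_add_dilate_eq hk, eq_zero_of_notMem_varyingIndices htouch hi hm, mul_zero,
    zero_add] at h1
  have hk' : (0 : ℝ) < √k := Real.sqrt_pos.2 (by exact_mod_cast hk)
  exact (mul_eq_zero.1 h1).resolve_left hk'.ne'

/-- Up to a factor depending only on `k`, the multinomial coefficients are products of Poisson
weights. -/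
theorem exists_coeff_eq_mul_poissonProd
    (htouch : ∀ i, (hyperplane v a i ∩ polyhedron v a).Nonempty) (hsum : ∑ i, v i = 0)
    (hm : minPoint v a ∈ polyhedron v a)
    (hmin : ∀ x ∈ polyhedron v a, logPotential v a (minPoint v a) ≤ logPotential v a x)
    {k : ℕ} (hk : 0 < k) :
    ∃ D : ℝ, 0 < D ∧ ∀ z ∈ latticePoints v (dilate k a),
      (coeff v (dilate k a) z : ℝ) = D * poissonProd v a k z := by
  have hk' : (0 : ℝ) < k := by exact_mod_cast hk
  have hpos : ∀ i ∈ varyingIndices v a, 0 < pairing (v i) (minPoint v a) + a i :=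
    fun i hi => pos_of_isMinOn hm hmin hi
  set I := varyingIndices v a with hI
  set t : Fin r → ℝ := fun i => k * (pairing (v i) (minPoint v a) + a i) with ht
  have htpos : ∀ i ∈ I, 0 < t i := fun i hi => mul_pos hk' (hpos i hi)
  set A : ℝ := ∏ i ∈ I, √(2 * Real.pi) * (√(t i) * Real.exp (-t i)) with hA
  have hApos : 0 < A := Finset.prod_pos fun i hi => by
    have := Real.sqrt_pos.2 (htpos i hi)
    have := Real.pi_pos
    positivity
  set S : ℝ := Real.exp (∑ i ∈ I, t i * Real.log (t i)) with hS
  refine ⟨(∑ i, dilate k a i).toNat.factorial / (A * S), by positivity, fun z hz => ?_⟩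
  set N : Fin r → ℕ := fun i => (∑ j, v i j * z j + dilate k a i).toNat with hN
  have hNcast : ∀ i, (N i : ℝ) = pairing (v i) (latticePoint z) + dilate k a i :=
    fun i => toNat_cast_eq (hz i)
  have hNsum : ∑ i, N i = (∑ i, dilate k a i).toNat := by
    have h1 : ((∑ i, N i : ℕ) : ℝ) = ((∑ i, dilate k a i : ℤ) : ℝ) := by
      push_cast
      simp_rw [hNcast]
      rw [Finset.sum_add_distrib, sum_pairing_eq_zero hsum, zero_add]
    have h2 : ((∑ i, N i : ℕ) : ℤ) = ∑ i, dilate k a i := by exact_mod_cast h1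
    rw [← h2, Int.toNat_natCast]
  have hy := rescale_mem_commonKernel htouch hm hk hz
  -- Entries outside `I` vanish on `kP` and contribute `0! = 1`.
  have hfac : ∏ i, (N i).factorial = ∏ i ∈ I, (N i).factorial := by
    refine (Finset.prod_subset (Finset.subset_univ I) fun i _ hi => ?_).symm
    have h1 := hNcast i
    rw [dilate_eq_zero_of_notMem_varyingIndices htouch hk hi hz, Nat.cast_eq_zero] at h1
    rw [h1, Nat.factorial_zero]
  have hspec : (∏ i ∈ I, ((N i).factorial : ℝ)) * coeff v (dilate k a) z =
      (∑ i, dilate k a i).toNat.factorial := by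
    have := Nat.multinomial_spec Finset.univ N
    rw [hfac, hNsum] at this
    exact_mod_cast this
  -- The heart of the comparison: with `N i = t i + √k ⟨vᵢ, y⟩`, the term in `log k` dies by `∑ vᵢ =
  -- 0` and the term in `log (⟨vᵢ, m⟩ + aᵢ)` by the first order condition.
  have hpow : ∏ i ∈ I, t i ^ N i = S := by
    have h1 : ∀ i ∈ I, t i ^ N i = Real.exp (N i * Real.log (t i)) := fun i hi => by
      rw [Real.exp_nat_mul, Real.exp_log (htpos i hi)]
    rw [Finset.prod_congr rfl h1, ← Real.exp_sum, hS]
    congr 1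
    rw [← sub_eq_zero, ← Finset.sum_sub_distrib]
    set y := rescale v a k (latticePoint z) with hydef
    have h2 : ∀ i ∈ I, N i * Real.log (t i) - t i * Real.log (t i) =
        √k * Real.log k * pairing (v i) y +
          √k * (pairing (v i) y * Real.log (pairing (v i) (minPoint v a) + a i)) := by
      intro i hi
      rw [hNcast, pairing_add_dilate_eq hk, ← hydef, ht]
      simp only
      rw [Real.log_mul hk'.ne' (hpos i hi).ne']
      ring
    rw [Finset.sum_congr rfl h2, Finset.sum_add_distrib, ← Finset.mul_sum, ← Finset.mul_sum,
      sum_varyingIndices_pairing hsum hy, sum_pairing_mul_log_eq_zero htouch hsum hm hmin hy,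
      mul_zero, mul_zero, add_zero]
  have hprod : poissonProd v a k z = A * S / ∏ i ∈ I, ((N i).factorial : ℝ) := by
    rw [poissonProd, hA, ← hpow, ← Finset.prod_mul_distrib, ← Finset.prod_div_distrib]
    refine Finset.prod_congr rfl fun i _ => ?_
    rw [scaledPoisson]
    ring
  have hF : (∏ i ∈ I, ((N i).factorial : ℝ)) ≠ 0 :=
    Finset.prod_ne_zero_iff.2 fun i _ => by positivity
  have hS0 : S ≠ 0 := (Real.exp_pos _).ne'
  rw [hprod, ← hspec]
  field_simp

theorem poissonProd_nonneg (hm : minPoint v a ∈ polyhedron v a) (k : ℕ) (z : Fin n → ℤ) :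
    0 ≤ poissonProd v a k z :=
  Finset.prod_nonneg fun i _ => mul_nonneg (Real.sqrt_nonneg _)
    (scaledPoisson_nonneg (mul_nonneg (Nat.cast_nonneg k) (hm i)) _)

theorem exists_pairing_le (hcompact : IsCompact (polyhedron v a)) :
    ∃ M : ℝ, 0 < M ∧ ∀ x ∈ polyhedron v a, ∀ i, pairing (v i) x + a i ≤ M := by
  have h : ∀ i, ∃ M : ℝ, ∀ x ∈ polyhedron v a, pairing (v i) x + a i ≤ M := by
    intro i
    obtain ⟨M, hM⟩ := hcompact.bddAbove_image
      ((continuous_pairing (v i)).add (continuous_const (y := (a i : ℝ)))).continuousOn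
    exact ⟨M, fun x hx => hM ⟨x, hx, rfl⟩⟩
  choose M hM using h
  refine ⟨∑ i, |M i| + 1, by positivity, fun x hx i => ?_⟩
  have := Finset.single_le_sum (f := fun i => |M i|) (fun i _ => abs_nonneg _) (Finset.mem_univ i)
  linarith [hM i x hx, le_abs_self (M i)]

theorem quadForm_nonneg (hm : minPoint v a ∈ polyhedron v a) (x : E n) : 0 ≤ quadForm v a x :=
  Finset.sum_nonneg fun i _ => div_nonneg (sq_nonneg _) (hm i)

theorem continuous_quadForm : Continuous (quadForm v a) :=
  continuous_finsetSum _ fun i _ => ((continuous_pairing (v i)).pow 2).div_const _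

/-- On `kP` every entry is `O(k)`, hence at most a fixed multiple `M` of its Poisson mean, so
`scaledPoisson_le_of_le_mul` applies uniformly. -/
theorem exists_poissonProd_le (hcompact : IsCompact (polyhedron v a))
    (hm : minPoint v a ∈ polyhedron v a)
    (hpos : ∀ i ∈ varyingIndices v a, 0 < pairing (v i) (minPoint v a) + a i) :
    ∃ C β : ℝ, 0 < C ∧ 0 < β ∧ ∀ k : ℕ, 0 < k → ∀ z ∈ latticePoints v (dilate k a),
      poissonProd v a k z ≤
        C * Real.exp (-β * quadForm v a (rescale v a k (latticePoint z))) := by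
  obtain ⟨M₀, hM₀, hM⟩ := exists_pairing_le hcompact
  set I := varyingIndices v a with hI
  set M : ℝ := ∑ i ∈ I, M₀ / (pairing (v i) (minPoint v a) + a i) with hMdef
  have hMnn : 0 ≤ M := Finset.sum_nonneg fun i hi => div_nonneg hM₀.le (hpos i hi).le
  have hMi : ∀ i ∈ I, M₀ ≤ M * (pairing (v i) (minPoint v a) + a i) := fun i hi => by
    rw [← div_le_iff₀ (hpos i hi)]
    exact Finset.single_le_sum
      (f := fun i => M₀ / (pairing (v i) (minPoint v a) + a i))
      (fun i hi => div_nonneg hM₀.le (hpos i hi).le) hi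
  refine ⟨∏ _i ∈ I, √(2 * Real.pi) * 2, (4 * (1 + M))⁻¹,
    Finset.prod_pos fun _ _ => by positivity, by positivity, fun k hk z hz => ?_⟩
  have hk' : (0 : ℝ) < k := by exact_mod_cast hk
  rw [quadForm, Finset.mul_sum, Real.exp_sum, ← Finset.prod_mul_distrib, poissonProd]
  refine Finset.prod_le_prod (fun i _ => mul_nonneg (Real.sqrt_nonneg _)
    (scaledPoisson_nonneg (mul_nonneg hk'.le (hm i)) _)) fun i hi => ?_
  rw [mul_assoc]
  refine mul_le_mul_of_nonneg_left ?_ (Real.sqrt_nonneg _)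
  have hμ := hpos i hi
  have hcast := toNat_cast_eq (hz i)
  have h1 : pairing (v i) (latticePoint z) + dilate k a i ≤
      M * (k * (pairing (v i) (minPoint v a) + a i)) := by
    have h2 := hM _ ((mem_polyhedron_dilate_iff hk).1 hz) i
    have h3 := mul_le_mul_of_nonneg_left (h2.trans (hMi i hi)) hk'.le
    rw [pairing_smul, dilate] at *
    push_cast
    have h4 : (k : ℝ) * ((k : ℝ)⁻¹ * pairing (v i) (latticePoint z) + a i) =
      pairing (v i) (latticePoint z) + k * a i := by field_simp
    rw [h4] at h3
    linarith
  rw [← hcast] at h1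
  refine (scaledPoisson_le_of_le_mul (mul_pos hk' hμ) hMnn h1).trans (le_of_eq ?_)
  congr 3
  rw [hcast, pairing_add_dilate_eq hk, add_sub_cancel_left, mul_pow, Real.sq_sqrt hk'.le]
  field_simp

/-- Varying entries equal a positive multiple of `k` plus `O(√k)`; the others are zero or fixed in
sign by the kernel condition. -/
theorem eventually_mem_latticePoints
    (hm : minPoint v a ∈ polyhedron v a)
    (hpos : ∀ i ∈ varyingIndices v a, 0 < pairing (v i) (minPoint v a) + a i)
    {z : ℕ → Fin n → ℤ} {y : E n}
    (hz : ∀ᶠ k in atTop, rescale v a k (latticePoint (z k)) ∈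
      commonKernel v {i | i ∉ varyingIndices v a})
    (hy : Tendsto (fun k => rescale v a k (latticePoint (z k))) atTop (𝓝 y)) :
    ∀ᶠ k in atTop, z k ∈ latticePoints v (dilate k a) := by
  have hsq : Tendsto (fun k : ℕ => √(k : ℝ)) atTop atTop :=
    Real.tendsto_sqrt_atTop.comp tendsto_natCast_atTop_atTop
  refine eventually_all.2 fun i => ?_
  by_cases hi : i ∈ varyingIndices v a
  · have h1 := (hsq.atTop_mul_const (hpos i hi)).atTop_add
      (((continuous_pairing (v i)).tendsto y).comp hy)
    filter_upwards [h1.eventually_ge_atTop 0, eventually_gt_atTop 0] with k hk hk0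
    have h2 := mul_nonneg (Real.sqrt_nonneg (k : ℝ)) hk
    rw [mul_add, ← mul_assoc, Real.mul_self_sqrt (Nat.cast_nonneg k)] at h2
    rwa [pairing_add_dilate_eq hk0]
  · filter_upwards [hz, eventually_gt_atTop 0] with k hk hk0
    rw [pairing_add_dilate_eq hk0, mem_commonKernel.1 hk i hi, mul_zero, add_zero]
    exact mul_nonneg (Nat.cast_nonneg k) (hm i)

theorem tendsto_poissonProd
    (hpos : ∀ i ∈ varyingIndices v a, 0 < pairing (v i) (minPoint v a) + a i)
    {z : ℕ → Fin n → ℤ} {y : E n}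
    (hz : ∀ᶠ k in atTop, z k ∈ latticePoints v (dilate k a))
    (hy : Tendsto (fun k => rescale v a k (latticePoint (z k))) atTop (𝓝 y)) :
    Tendsto (fun k => poissonProd v a k (z k)) atTop
      (𝓝 (Real.exp (-(1 / 2) * quadForm v a y))) := by
  rw [quadForm, Finset.mul_sum, Real.exp_sum]
  refine tendsto_finsetProd _ fun i hi => tendsto_scaledPoisson (hpos i hi) ?_
  refine (((continuous_pairing (v i)).tendsto y).comp hy).congr' ?_
  filter_upwards [hz, eventually_gt_atTop 0] with k hk hk0
  have hk' : (0 : ℝ) < √k := Real.sqrt_pos.2 (by exact_mod_cast hk0)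
  rw [toNat_cast_eq (hk i), pairing_add_dilate_eq hk0, add_sub_cancel_left,
    inv_mul_cancel_left₀ hk'.ne', Function.comp_apply]

/-! ### Rescaled lattice points and the limit of weighted sums. -/

theorem rescale_injective {k : ℕ} (hk : 0 < k) :
    Function.Injective (rescale v a k) := by
  intro x y h
  have hk' : (0 : ℝ) < √k := Real.sqrt_pos.2 (by exact_mod_cast hk)
  exact sub_left_injective (smul_right_injective (E n) (inv_ne_zero hk'.ne') h)

/-- The rescaled lattice points parallel to `P` form a linear image of shifted and scaled copies
of `ℤᵈ`. -/
theorem exists_rescaled_parametrization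
    (htouch : ∀ i, (hyperplane v a i ∩ polyhedron v a).Nonempty)
    (hm : minPoint v a ∈ polyhedron v a)
    (hlattice : ∀ᶠ k : ℕ in atTop, (latticePoints v (dilate k a)).Nonempty) :
    ∃ (d : ℕ) (Φ : (Fin d → ℝ) →ₗ[ℝ] E n) (s : ℕ → Fin d → ℝ)
      (p : ℕ → (Fin d → ℤ) → Fin n → ℤ), Function.Injective Φ ∧
      (∀ t, Φ t ∈ commonKernel v {i | i ∉ varyingIndices v a}) ∧
      ∀ᶠ k : ℕ in atTop, Function.Injective (p k) ∧
        (∀ w, rescale v a k (latticePoint (p k w)) =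
          Φ (fun j => (√(k : ℝ))⁻¹ * (w j + s k j))) ∧
        ∀ z, rescale v a k (latticePoint z) ∈ commonKernel v {i | i ∉ varyingIndices v a} →
          z ∈ Set.range (p k) := by
  obtain ⟨d, Φ, hinj, hrange, hlat, hlat'⟩ :=
    exists_lattice_parametrization v {i | i ∉ varyingIndices v a}
  choose q hq using hlat'
  have hqinj : Function.Injective q := by
    intro w w' h
    have h1 : Φ (fun j => (w j : ℝ)) = Φ (fun j => (w' j : ℝ)) := by rw [hq, hq, h]
    funext j
    exact_mod_cast congrFun (hinj h1) j
  have hbase : ∀ᶠ k : ℕ in atTop, ∃ (z₀ : Fin n → ℤ) (s : Fin d → ℝ), 0 < k ∧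
      Φ s = latticePoint z₀ - (k : ℝ) • minPoint v a := by
    filter_upwards [hlattice, eventually_gt_atTop 0] with k ⟨z₀, hz₀⟩ hk
    have hk' : (0 : ℝ) < √k := Real.sqrt_pos.2 (by exact_mod_cast hk)
    have h1 := Submodule.smul_mem _ (√(k : ℝ)) (rescale_mem_commonKernel htouch hm hk hz₀)
    rw [rescale, smul_inv_smul₀ hk'.ne'] at h1
    obtain ⟨s, hs⟩ := (hrange _).1 h1
    exact ⟨z₀, s, hk, hs⟩
  -- The base point `z₀` is available only for large `k`; the implication extends the choice to all
  -- `k`. The shift `s` holds the coordinates of `z₀ - k m`.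
  have hchoice : ∀ k : ℕ, ∃ (z₀ : Fin n → ℤ) (s : Fin d → ℝ),
      (∃ (z₀ : Fin n → ℤ) (s : Fin d → ℝ), 0 < k ∧
        Φ s = latticePoint z₀ - (k : ℝ) • minPoint v a) →
      0 < k ∧ Φ s = latticePoint z₀ - (k : ℝ) • minPoint v a := by
    intro k
    by_cases h : ∃ (z₀ : Fin n → ℤ) (s : Fin d → ℝ), 0 < k ∧
        Φ s = latticePoint z₀ - (k : ℝ) • minPoint v a
    · obtain ⟨z₀, s, hs⟩ := h
      exact ⟨z₀, s, fun _ => hs⟩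
    · exact ⟨0, 0, fun h' => absurd h' h⟩
  choose z₀ s hs using hchoice
  refine ⟨d, Φ, s, fun k w => z₀ k + q w, hinj, fun t => (hrange _).2 ⟨t, rfl⟩, ?_⟩
  filter_upwards [hbase] with k hk
  obtain ⟨hk0, hsk⟩ := hs k hk
  have hk' : (0 : ℝ) < √k := Real.sqrt_pos.2 (by exact_mod_cast hk0)
  refine ⟨(add_right_injective _).comp hqinj, fun w => ?_, fun z hz => ?_⟩
  · have h1 : (fun j => (√(k : ℝ))⁻¹ * ((w j : ℝ) + s k j)) =
        (√(k : ℝ))⁻¹ • ((fun j => (w j : ℝ)) + s k) := by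
      funext j; simp
    rw [h1, map_smul, map_add, hsk, hq, rescale, latticePoint_add]
    congr 1
    abel
  · have h1 := Submodule.smul_mem _ (√(k : ℝ)) hz
    rw [rescale, smul_inv_smul₀ hk'.ne'] at h1
    have h2 := Submodule.sub_mem _ h1 ((hrange _).2 ⟨_, hsk⟩)
    rw [sub_sub_sub_cancel_right, ← latticePoint_sub] at h2
    obtain ⟨w, hw⟩ := hlat _ h2
    refine ⟨w, ?_⟩
    have h3 : q w = z - z₀ k := latticePoint_injective ((hq w).symm.trans hw)
    simp [h3]

/-- Positive definiteness on the direction space: there the varying pairings determine the vector,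
by compactness of `P`, and the denominators are bounded by `M`. -/
theorem exists_quadForm_ge {d : ℕ} (hcompact : IsCompact (polyhedron v a))
    (hm : minPoint v a ∈ polyhedron v a)
    (hpos : ∀ i ∈ varyingIndices v a, 0 < pairing (v i) (minPoint v a) + a i)
    {Φ : (Fin d → ℝ) →ₗ[ℝ] E n} (hinj : Function.Injective Φ)
    (hΦ : ∀ t, Φ t ∈ commonKernel v {i | i ∉ varyingIndices v a}) :
    ∃ γ : ℝ, 0 < γ ∧ ∀ t, γ * ∑ j, t j ^ 2 ≤ quadForm v a (Φ t) := by
  obtain ⟨M, hM0, hM⟩ := exists_pairing_le hcompact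
  let T : (Fin d → ℝ) →ₗ[ℝ] (Fin r → ℝ) := LinearMap.pi fun i => pairingL (v i) ∘ₗ Φ
  have hT : LinearMap.ker T = ⊥ := by
    refine LinearMap.ker_eq_bot'.2 fun t ht => ?_
    have := eq_zero_of_forall_pairing_eq_zero hcompact ⟨_, hm⟩ (y := Φ t)
      fun i => congrFun ht i
    exact hinj (this.trans (map_zero Φ).symm)
  obtain ⟨K, hK0, hK⟩ := T.exists_antilipschitzWith hT
  have hKt : ∀ t, ‖t‖ ≤ K * ‖T t‖ := fun t => by
    have := hK.le_mul_dist t 0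
    simpa using this
  refine ⟨(d * K ^ 2 * M + 1)⁻¹, by positivity, fun t => ?_⟩
  rw [inv_mul_le_iff₀ (by positivity)]
  have h1 : ∑ j, t j ^ 2 ≤ d * ‖t‖ ^ 2 := by
    have : ∑ j, t j ^ 2 ≤ ∑ _j : Fin d, ‖t‖ ^ 2 := Finset.sum_le_sum fun j _ => by
      rw [← sq_abs]
      exact pow_le_pow_left₀ (abs_nonneg _) (norm_le_pi_norm t j) 2
    simpa using this
  have h2 : ‖T t‖ ^ 2 ≤ ∑ i ∈ varyingIndices v a, pairing (v i) (Φ t) ^ 2 := by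
    have hnn : 0 ≤ ∑ i ∈ varyingIndices v a, pairing (v i) (Φ t) ^ 2 :=
      Finset.sum_nonneg fun i _ => sq_nonneg _
    rw [← Real.le_sqrt (norm_nonneg _) hnn, pi_norm_le_iff_of_nonneg (Real.sqrt_nonneg _)]
    intro i
    refine Real.abs_le_sqrt ?_
    change pairing (v i) (Φ t) ^ 2 ≤ _
    by_cases hi : i ∈ varyingIndices v a
    · exact Finset.single_le_sum (f := fun i => pairing (v i) (Φ t) ^ 2)
        (fun i _ => sq_nonneg _) hi
    · rw [mem_commonKernel.1 (hΦ t) i hi]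
      simpa using hnn
  have h3 : ∑ i ∈ varyingIndices v a, pairing (v i) (Φ t) ^ 2 ≤ M * quadForm v a (Φ t) := by
    rw [quadForm, Finset.mul_sum]
    refine Finset.sum_le_sum fun i hi => ?_
    rw [mul_div_assoc', le_div_iff₀ (hpos i hi), mul_comm]
    exact mul_le_mul_of_nonneg_right (hM _ hm i) (sq_nonneg _)
  have h4 : ‖t‖ ^ 2 ≤ K ^ 2 * ‖T t‖ ^ 2 := by
    rw [← mul_pow]
    exact pow_le_pow_left₀ (norm_nonneg _) (hKt t) 2
  have h5 := quadForm_nonneg hm (Φ t)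
  calc ∑ j, t j ^ 2 ≤ d * (K ^ 2 * (M * quadForm v a (Φ t))) :=
        h1.trans (by gcongr; exact h4.trans (by gcongr; exact h2.trans h3))
    _ ≤ _ := by nlinarith

/-- The common engine for the Poisson weights and the truncated Gaussian weights. Convergence is
asked along convergent sequences of points, the form in which dominated convergence uses it. -/
theorem tendsto_weighted_lattice_sum {d : ℕ} {Φ : (Fin d → ℝ) →ₗ[ℝ] E n} {s : ℕ → Fin d → ℝ}
    {p : ℕ → (Fin d → ℤ) → Fin n → ℤ}
    (hΦ : ∀ t, Φ t ∈ commonKernel v {i | i ∉ varyingIndices v a})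
    (hp : ∀ᶠ k : ℕ in atTop, Function.Injective (p k) ∧
        (∀ w, rescale v a k (latticePoint (p k w)) =
          Φ (fun j => (√(k : ℝ))⁻¹ * (w j + s k j))) ∧
        ∀ z, rescale v a k (latticePoint z) ∈ commonKernel v {i | i ∉ varyingIndices v a} →
          z ∈ Set.range (p k))
    {γ : ℝ} (hγ : 0 < γ) (hQ : ∀ t, γ * ∑ j, t j ^ 2 ≤ quadForm v a (Φ t))
    {g : ℕ → (Fin n → ℤ) → ℝ} {C β : ℝ} (hC : 0 ≤ C) (hβ : 0 < β)
    (hgsupp : ∀ᶠ k in atTop, ∀ z, g k z ≠ 0 →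
      rescale v a k (latticePoint z) ∈ commonKernel v {i | i ∉ varyingIndices v a})
    (hgle : ∀ᶠ k in atTop, ∀ z,
      |g k z| ≤ C * Real.exp (-β * quadForm v a (rescale v a k (latticePoint z))))
    (hglim : ∀ (z : ℕ → Fin n → ℤ) (y : E n),
      (∀ᶠ k in atTop, rescale v a k (latticePoint (z k)) ∈
        commonKernel v {i | i ∉ varyingIndices v a}) →
      Tendsto (fun k => rescale v a k (latticePoint (z k))) atTop (𝓝 y) →
      Tendsto (fun k => g k (z k)) atTop (𝓝 (Real.exp (-(1 / 2) * quadForm v a y))))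
    {f : ℕ → E n → ℝ} {B : ℝ} (hfB : ∀ k x, |f k x| ≤ B) {f' : E n → ℝ}
    (hf : ∀ (x : ℕ → E n) (y : E n), Tendsto x atTop (𝓝 y) →
      Tendsto (fun k => f k (x k)) atTop (𝓝 (f' y))) :
    Tendsto (fun k : ℕ => (√(k : ℝ))⁻¹ ^ d *
      ∑' z, g k z * f k (rescale v a k (latticePoint z))) atTop
      (𝓝 (∫ t, Real.exp (-(1 / 2) * quadForm v a (Φ t)) * f' (Φ t))) := by
  have hsq0 : Tendsto (fun k : ℕ => (√(k : ℝ))⁻¹) atTop (𝓝 0) :=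
    tendsto_inv_atTop_zero.comp (Real.tendsto_sqrt_atTop.comp tendsto_natCast_atTop_atTop)
  have hpos : ∀ᶠ k : ℕ in atTop, 0 < (√(k : ℝ))⁻¹ := by
    filter_upwards [eventually_gt_atTop 0] with k hk
    exact inv_pos.2 (Real.sqrt_pos.2 (by exact_mod_cast hk))
  have hmain := tendsto_shifted_lattice_sum hpos hsq0 s
    (fun k w => g k (p k w) * f k (rescale v a k (latticePoint (p k w))))
    (fun t => Real.exp (-(1 / 2) * quadForm v a (Φ t)) * f' (Φ t))
    (C := C * B) (mul_pos hβ hγ) ?_ ?_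
  · refine hmain.congr' ?_
    filter_upwards [hp, hgsupp] with k ⟨hinj, _, hr⟩ hsupp
    congr 1
    refine hinj.tsum_eq (f := fun z => g k z * f k (rescale v a k (latticePoint z)))
      fun z hz => hr z (hsupp z (left_ne_zero_of_mul hz))
  · filter_upwards [hp, hgle] with k ⟨_, hval, _⟩ hle w
    have h1 := hle (p k w)
    have h2 : Real.exp (-β * quadForm v a (rescale v a k (latticePoint (p k w)))) ≤
        Real.exp (-(β * γ) * ∑ j, ((√(k : ℝ))⁻¹ * (w j + s k j)) ^ 2) := by
      refine Real.exp_le_exp.2 ?_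
      rw [hval]
      have := mul_le_mul_of_nonneg_left (hQ fun j => (√(k : ℝ))⁻¹ * (w j + s k j)) hβ.le
      linarith
    have h3 : |g k (p k w)| ≤ _ := h1.trans (mul_le_mul_of_nonneg_left h2 hC)
    rw [abs_mul, mul_right_comm]
    exact mul_le_mul h3 (hfB _ _) (abs_nonneg _) ((abs_nonneg _).trans h3)
  · intro t w hw
    have h1 : Tendsto (fun k => rescale v a k (latticePoint (p k (w k)))) atTop (𝓝 (Φ t)) := by
      refine ((Φ.continuous_of_finiteDimensional.tendsto t).comp hw).congr' ?_
      filter_upwards [hp] with k ⟨_, hval, _⟩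
      rw [hval, Function.comp_apply]
    refine (hglim _ _ ?_ h1).mul (hf _ _ h1)
    filter_upwards [hp] with k ⟨_, hval, _⟩
    rw [hval]
    exact hΦ _

/-! ### Integrals against the two measures as lattice sums. -/

theorem integral_weightMeasure {b : Fin r → ℤ} (hfin : (latticePoints v b).Finite)
    (F : E n → ℝ) :
    ∫ x, F x ∂(weightMeasure v b) =
      ∑' z, (latticePoints v b).indicator (fun z => (coeff v b z : ℝ)) z * F (latticePoint z) := by
  have := hfin.fintype
  rw [weightMeasure, Measure.sum_fintype, integral_finsetSum_measure]
  · simp_rw [integral_smul_measure, integral_dirac]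
    have h1 : ∀ z, (latticePoints v b).indicator (fun z => (coeff v b z : ℝ)) z *
        F (latticePoint z) =
        (latticePoints v b).indicator (fun z => (coeff v b z : ℝ) * F (latticePoint z)) z :=
      fun z => (Set.indicator_mul_left _ _ fun z => F (latticePoint z)).symm
    simp_rw [h1]
    rw [← tsum_subtype, tsum_fintype]
    simp
  · intro z _
    exact (integrable_dirac (by simp)).smul_measure (ENNReal.natCast_ne_top _)

theorem integral_law {b : Fin r → ℤ} (hfin : (latticePoints v b).Finite) (F : E n → ℝ)
    {D : ℝ} (hD : D ≠ 0) {g : (Fin n → ℤ) → ℝ}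
    (hg : ∀ z ∈ latticePoints v b, (coeff v b z : ℝ) = D * g z) :
    ∫ x, F x ∂(law v b) =
      (∑' z, (latticePoints v b).indicator g z * F (latticePoint z)) /
        ∑' z, (latticePoints v b).indicator g z := by
  have key : ∀ F : E n → ℝ, ∫ x, F x ∂(weightMeasure v b) =
      D * ∑' z, (latticePoints v b).indicator g z * F (latticePoint z) := by
    intro F
    rw [integral_weightMeasure hfin, ← tsum_mul_left]
    refine tsum_congr fun z => ?_
    by_cases hz : z ∈ latticePoints v b
    · rw [Set.indicator_of_mem hz, Set.indicator_of_mem hz, hg z hz, mul_assoc]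
    · simp [Set.indicator_of_notMem hz]
  have hmass : (weightMeasure v b Set.univ).toReal =
      D * ∑' z, (latticePoints v b).indicator g z := by
    have := key fun _ => 1
    simpa [Measure.real] using this
  rw [law, integral_smul_measure, key, ENNReal.toReal_inv, hmass, smul_eq_mul, mul_inv]
  field_simp

theorem integral_gaussSum {c : ℝ} {k : ℕ} (hk : 0 < k) (f : E n → ℝ) :
    ∫ x, f x ∂(gaussSum v a c k : Measure (E n)) =
      ∑' z, ((fun z => rescale v a k (latticePoint z)) ⁻¹' gaussSupport v a c k).indicator
        (fun z => Real.exp (-(1 / 2) * quadForm v a (rescale v a k (latticePoint z)))) z *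
          f (rescale v a k (latticePoint z)) := by
  have hinj : Function.Injective fun z : Fin n → ℤ => rescale v a k (latticePoint z) :=
    (rescale_injective hk).comp latticePoint_injective
  have h1 : ∫ x, f x ∂(gaussSum v a c k : Measure (E n)) =
      ∑ x ∈ (finite_gaussSupport v a c k).toFinset,
        Real.exp (-(1 / 2) * quadForm v a x) * f x := by
    change ∫ x, f x ∂(∑ x ∈ (finite_gaussSupport v a c k).toFinset,
      Real.toNNReal (Real.exp (-(1 / 2) * quadForm v a x)) • Measure.dirac x) = _
    rw [integral_finsetSum_measure]
    · refine Finset.sum_congr rfl fun x _ => ?_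
      rw [integral_smul_nnreal_measure, integral_dirac, NNReal.smul_def,
        Real.coe_toNNReal _ (Real.exp_pos _).le, smul_eq_mul]
    · intro x _
      exact (integrable_dirac (by simp)).smul_measure_nnreal
  have h2 : ∑ x ∈ (finite_gaussSupport v a c k).toFinset,
        Real.exp (-(1 / 2) * quadForm v a x) * f x =
      ∑' x, (gaussSupport v a c k).indicator
        (fun x => Real.exp (-(1 / 2) * quadForm v a x) * f x) x := by
    rw [tsum_eq_sum (s := (finite_gaussSupport v a c k).toFinset)]
    · refine Finset.sum_congr rfl fun x hx => ?_
      rw [Set.indicator_of_mem (by simpa using hx)]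
    · intro x hx
      exact Set.indicator_of_notMem (by simpa using hx) _
  rw [h1, h2, ← hinj.tsum_eq]
  · refine tsum_congr fun z => ?_
    by_cases hz : rescale v a k (latticePoint z) ∈ gaussSupport v a c k
    · rw [Set.indicator_of_mem hz, Set.indicator_of_mem (by exact hz)]
    · rw [Set.indicator_of_notMem hz, Set.indicator_of_notMem (by exact hz), zero_mul]
  · exact Set.support_indicator_subset.trans fun x hx => hx.2

/-- The radius `k ^ c` tends to infinity, so the truncation is eventually inactive along a
convergent sequence. -/
theorem tendsto_indicator_gaussSupport {c : ℝ} (hc : 0 < c)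
    (htouch : ∀ i, (hyperplane v a i ∩ polyhedron v a).Nonempty)
    (hne : (polyhedron v a).Nonempty) {z : ℕ → Fin n → ℤ} {y : E n}
    (hz : ∀ᶠ k in atTop, rescale v a k (latticePoint (z k)) ∈
      commonKernel v {i | i ∉ varyingIndices v a})
    (hy : Tendsto (fun k => rescale v a k (latticePoint (z k))) atTop (𝓝 y)) :
    Tendsto (fun k =>
      ((fun z => rescale v a k (latticePoint z)) ⁻¹' gaussSupport v a c k).indicator
        (fun z => Real.exp (-(1 / 2) * quadForm v a (rescale v a k (latticePoint z)))) (z k)) atTop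
      (𝓝 (Real.exp (-(1 / 2) * quadForm v a y))) := by
  have h1 := (((continuous_quadForm (v := v) (a := a)).tendsto y).comp hy).const_mul (-(1 / 2)) |>.rexp
  refine h1.congr' ?_
  have h2 : ∀ᶠ k : ℕ in atTop, ‖y‖ + 1 < (k : ℝ) ^ c :=
    ((tendsto_rpow_atTop hc).comp tendsto_natCast_atTop_atTop).eventually_gt_atTop _
  filter_upwards [hz, h2, (tendsto_order.1 hy.norm).2 (‖y‖ + 1) (by linarith)] with k hk hk2 hk3
  rw [Set.indicator_of_mem, Function.comp_apply]
  refine ⟨⟨?_, (mem_directionSpace_iff htouch hne).2 hk⟩, ⟨z k, rfl⟩⟩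
  rw [mem_ball_zero_iff]
  exact hk3.trans hk2

theorem norm_rescale_ge_iff {c : ℝ} {k : ℕ} (hk : 0 < k) (x : E n) :
    x ∈ (Metric.ball ((k : ℝ) • minPoint v a) ((k : ℝ) ^ (1 / 2 + c)))ᶜ ↔
      (k : ℝ) ^ c ≤ ‖rescale v a k x‖ := by
  have hk0 : (0 : ℝ) < k := by exact_mod_cast hk
  have hk' : (0 : ℝ) < √k := Real.sqrt_pos.2 hk0
  rw [Set.mem_compl_iff, Metric.mem_ball, not_lt, dist_eq_norm, rescale, norm_smul, norm_inv,
    Real.norm_of_nonneg hk'.le, le_inv_mul_iff₀ hk', Real.rpow_add hk0, ← Real.sqrt_eq_rpow]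

end PolyMultinomial

/-! ### The proposition. -/

open PolyMultinomial in
theorem proposition3p1 {n r : ℕ} (v : Fin r → Fin n → ℤ) (a : Fin r → ℤ)
    (hcompact : IsCompact (PolyMultinomial.polyhedron v a))
    (htouch : ∀ i, (PolyMultinomial.hyperplane v a i ∩ PolyMultinomial.polyhedron v a).Nonempty)
    (hsum : ∑ i, v i = 0)
    (hlattice : ∀ᶠ k : ℕ in atTop,
      (PolyMultinomial.latticePoints v (PolyMultinomial.dilate k a)).Nonempty)
    (c : ℝ) (hc0 : 0 < c) (hc1 : c < 1 / 6) :
    (∃ d : ℕ → ℝ≥0, (∀ k, 0 < d k) ∧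
      ∃ ρ : ProbabilityMeasure (PolyMultinomial.E n),
        Tendsto (fun k => PolyMultinomial.nuPrime v a k) atTop (𝓝 ρ.toFiniteMeasure) ∧
        Tendsto (fun k => (d k)⁻¹ • PolyMultinomial.gaussSum v a c k) atTop
          (𝓝 ρ.toFiniteMeasure)) ∧
    Tendsto (fun k : ℕ => PolyMultinomial.law v (PolyMultinomial.dilate k a)
      (Metric.ball ((k : ℝ) • PolyMultinomial.minPoint v a) ((k : ℝ) ^ (1 / 2 + c)))ᶜ)
      atTop (𝓝 0) := by
  have hne : (polyhedron v a).Nonempty := by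
    obtain ⟨k, ⟨z, hz⟩, hk⟩ := (hlattice.and (eventually_gt_atTop 0)).exists
    exact ⟨_, (mem_polyhedron_dilate_iff hk).1 hz⟩
  obtain ⟨hm, hmin⟩ := minPoint_spec hcompact htouch hne
  have hpos : ∀ i ∈ varyingIndices v a, 0 < pairing (v i) (minPoint v a) + a i :=
    fun i hi => pos_of_isMinOn hm hmin hi
  obtain ⟨d, Φ, s, p, hinj, hΦ, hp⟩ := exists_rescaled_parametrization htouch hm hlattice
  obtain ⟨γ, hγ, hQ⟩ := exists_quadForm_ge hcompact hm hpos hinj hΦ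
  obtain ⟨C, β, hC, hβ, hCle⟩ := exists_poissonProd_le hcompact hm hpos
  have hΦc : Continuous Φ := Φ.continuous_of_finiteDimensional
  set q : (Fin d → ℝ) → ℝ := fun t => -(1 / 2) * quadForm v a (Φ t) with hq
  have hqc : Continuous q := (continuous_quadForm.comp hΦc).const_mul _
  have hqint : Integrable fun t => Real.exp (q t) := by
    refine (integrable_exp_neg_mul_sum_sq (half_pos hγ)).mono'
      (Real.continuous_exp.comp hqc).aestronglyMeasurable (Eventually.of_forall fun t => ?_)
    rw [Real.norm_of_nonneg (Real.exp_pos _).le]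
    refine Real.exp_le_exp.2 ?_
    simp only [hq]
    linarith [hQ t]
  set Z : ℝ := ∫ t, Real.exp (q t) with hZ
  have hZpos : 0 < Z := integral_exp_pos hqint
  have hkpos : ∀ᶠ k : ℕ in atTop, 0 < k := eventually_gt_atTop 0
  have hlawsum : ∀ {f : ℕ → E n → ℝ} {B : ℝ} (_ : ∀ k x, |f k x| ≤ B) {f' : E n → ℝ}
      (_ : ∀ (x : ℕ → E n) (y : E n), Tendsto x atTop (𝓝 y) →
        Tendsto (fun k => f k (x k)) atTop (𝓝 (f' y))),
      Tendsto (fun k : ℕ => (√(k : ℝ))⁻¹ ^ d *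
        ∑' z, (latticePoints v (dilate k a)).indicator (poissonProd v a k) z *
          f k (rescale v a k (latticePoint z))) atTop
        (𝓝 (∫ t, Real.exp (q t) * f' (Φ t))) := by
    intro f B hfB f' hf
    refine tendsto_weighted_lattice_sum hΦ hp hγ hQ hC.le hβ ?_ ?_ ?_ hfB hf
    · filter_upwards [hkpos] with k hk z hz
      exact rescale_mem_commonKernel htouch hm hk
        (Set.mem_of_indicator_ne_zero (s := latticePoints v (dilate k a)) hz)
    · filter_upwards [hkpos] with k hk z
      by_cases hz : z ∈ latticePoints v (dilate k a)
      · rw [Set.indicator_of_mem hz, abs_of_nonneg (poissonProd_nonneg hm k z)]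
        exact hCle k hk z hz
      · rw [Set.indicator_of_notMem hz, abs_zero]
        positivity
    · intro z y hz hy
      have hmem := eventually_mem_latticePoints hm hpos hz hy
      refine (tendsto_poissonProd hpos hmem hy).congr' ?_
      filter_upwards [hmem] with k hk
      rw [Set.indicator_of_mem hk]
  have hlaw : ∀ {f : ℕ → E n → ℝ} {B : ℝ} (_ : ∀ k x, |f k x| ≤ B) {f' : E n → ℝ}
      (_ : ∀ (x : ℕ → E n) (y : E n), Tendsto x atTop (𝓝 y) →
        Tendsto (fun k => f k (x k)) atTop (𝓝 (f' y))),
      Tendsto (fun k : ℕ => ∫ x, f k (rescale v a k x) ∂(law v (dilate k a))) atTop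
        (𝓝 ((∫ t, Real.exp (q t) * f' (Φ t)) / Z)) := by
    intro f B hfB f' hf
    -- The constant test function gives the asymptotics of the normalisation; the mesh factor and
    -- `D` cancel in the quotient.
    have h1 := hlawsum (f := fun _ _ => 1) (B := 1) (f' := fun _ => 1) (by simp)
      fun _ _ _ => tendsto_const_nhds
    simp only [mul_one] at h1
    refine ((hlawsum hfB hf).div h1 hZpos.ne').congr' ?_
    filter_upwards [hkpos] with k hk
    obtain ⟨D, hD, hDz⟩ := exists_coeff_eq_mul_poissonProd htouch hsum hm hmin hk
    have hk' : (0 : ℝ) < √k := Real.sqrt_pos.2 (by exact_mod_cast hk)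
    rw [integral_law (finite_latticePoints_dilate hcompact hk) _ hD.ne' hDz,
      Pi.div_apply, mul_div_mul_left _ _ (by positivity)]
  have hbdd : ∀ f : BoundedContinuousFunction (E n) ℝ, ∀ (_ : ℕ) (x : E n), |f x| ≤ ‖f‖ :=
    fun f _ x => f.norm_coe_le_norm x
  have hcts : ∀ (f : BoundedContinuousFunction (E n) ℝ) (x : ℕ → E n) (y : E n),
      Tendsto x atTop (𝓝 y) → Tendsto (fun k => f (x k)) atTop (𝓝 (f y)) :=
    fun f x y h => (f.continuous.tendsto y).comp h
  have hprob : IsProbabilityMeasure ((volume : Measure (Fin d → ℝ)).tilted q) :=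
    isProbabilityMeasure_tilted hqint
  -- The limit: the normalised density `exp q` on `ℝᵈ`, pushed forward to the direction space.
  set ρ : ProbabilityMeasure (E n) :=
    ⟨((volume : Measure (Fin d → ℝ)).tilted q).map Φ,
      Measure.isProbabilityMeasure_map hΦc.aemeasurable⟩
  have hρ : ∀ f : BoundedContinuousFunction (E n) ℝ,
      ∫ x, f x ∂(ρ.toFiniteMeasure : Measure (E n)) =
        (∫ t, Real.exp (q t) * f (Φ t)) / Z := by
    intro f
    change ∫ x, f x ∂(((volume : Measure (Fin d → ℝ)).tilted q).map Φ) = _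
    rw [integral_map hΦc.aemeasurable f.continuous.aestronglyMeasurable, integral_tilted,
      ← integral_div]
    refine integral_congr_ae (Eventually.of_forall fun t => ?_)
    simp only [smul_eq_mul]
    rw [div_mul_eq_mul_div]
  -- `d k` is the Gaussian mass `Z` divided by the cell volume `(1 / √k) ^ d`; `max k 1` only keeps
  -- it positive at `k = 0`.
  refine ⟨⟨fun k => Real.toNNReal (Z * (√((max k 1 : ℕ) : ℝ)) ^ d), fun k => ?_, ρ, ?_, ?_⟩, ?_⟩
  · have h1 : (0 : ℝ) < ((max k 1 : ℕ) : ℝ) := by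
      exact_mod_cast lt_of_lt_of_le zero_lt_one (le_max_right k 1)
    have := Real.sqrt_pos.2 h1
    exact Real.toNNReal_pos.2 (by positivity)
  · rw [FiniteMeasure.tendsto_iff_forall_integral_tendsto]
    intro f
    rw [hρ]
    refine (hlaw (f := fun _ => f) (hbdd f) (hcts f)).congr fun k => ?_
    change _ = ∫ x, f x ∂((law v (dilate k a)).map (rescale v a k))
    have hr : Continuous (rescale v a k) := by unfold rescale; fun_prop
    rw [integral_map hr.aemeasurable f.continuous.aestronglyMeasurable]
  · rw [FiniteMeasure.tendsto_iff_forall_integral_tendsto]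
    intro f
    rw [hρ]
    have h1 := tendsto_weighted_lattice_sum hΦ hp hγ hQ zero_le_one (half_pos one_pos)
      (g := fun k => ((fun z => rescale v a k (latticePoint z)) ⁻¹'
        gaussSupport v a c k).indicator
        (fun z => Real.exp (-(1 / 2) * quadForm v a (rescale v a k (latticePoint z)))))
      ?_ ?_ ?_ (f := fun _ => f) (hbdd f) (hcts f)
    · refine (h1.div_const Z).congr' ?_
      filter_upwards [hkpos] with k hk
      rw [FiniteMeasure.toMeasure_smul, integral_smul_nnreal_measure, integral_gaussSum hk,
        max_eq_left hk, NNReal.smul_def, NNReal.coe_inv, Real.coe_toNNReal _ (by positivity),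
        smul_eq_mul, mul_inv, inv_pow]
      ring
    · refine Eventually.of_forall fun k z hz => ?_
      exact (mem_directionSpace_iff htouch hne).1 (Set.mem_of_indicator_ne_zero hz).1.2
    · refine Eventually.of_forall fun k z => ?_
      rw [one_mul]
      by_cases hz : z ∈ (fun z => rescale v a k (latticePoint z)) ⁻¹' gaussSupport v a c k
      · rw [Set.indicator_of_mem hz, abs_of_pos (Real.exp_pos _)]
      · rw [Set.indicator_of_notMem hz, abs_zero]
        positivity
    · exact fun z y hz hy => tendsto_indicator_gaussSupport hc0 htouch hne hz hy
  -- The tail is the integral of a `k`-dependent indicator that vanishes eventually along every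
  -- convergent sequence, so its limit function is `0`.
  · have h1 := hlaw (f := fun k => {y : E n | (k : ℝ) ^ c ≤ ‖y‖}.indicator fun _ => (1 : ℝ))
      (B := 1) (f' := fun _ => 0) (fun k x => ?_) (fun x y hxy => ?_)
    · simp only [mul_zero, integral_zero, zero_div] at h1
      rw [← ENNReal.tendsto_toReal_iff (fun k => measure_ne_top _ _) ENNReal.zero_ne_top,
        ENNReal.toReal_zero]
      refine h1.congr' ?_
      filter_upwards [hkpos] with k hk
      rw [← Measure.real, ← integral_indicator_one Metric.isOpen_ball.measurableSet.compl]
      refine integral_congr_ae (Eventually.of_forall fun x => ?_)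
      change Set.indicator _ _ _ = _
      by_cases hx : rescale v a k x ∈ {y : E n | (k : ℝ) ^ c ≤ ‖y‖}
      · rw [Set.indicator_of_mem hx, Set.indicator_of_mem ((norm_rescale_ge_iff hk x).2 hx),
          Pi.one_apply]
      · rw [Set.indicator_of_notMem hx,
          Set.indicator_of_notMem (mt (norm_rescale_ge_iff hk x).1 hx)]
    · simp only [Set.indicator_apply]
      split_ifs <;> simp
    · refine tendsto_const_nhds.congr' ?_
      have h2 : ∀ᶠ k : ℕ in atTop, ‖y‖ + 1 < (k : ℝ) ^ c :=
        ((tendsto_rpow_atTop hc0).comp tendsto_natCast_atTop_atTop).eventually_gt_atTop _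
      filter_upwards [h2, (tendsto_order.1 hxy.norm).2 (‖y‖ + 1) (by linarith)] with k hk hk2
      rw [Set.indicator_of_notMem]
      exact not_le.2 (hk2.trans hk)
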